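/- **Setting.** Let $K$ be a field. Let $\alpha$ be a type of abstract power-products: a cancellative commutative monoid with least common multiples in which $1$ is the only invertible element, and which admits a Dickson grading, i.e. a map $d:\alpha\to\mathbb N$ with $d(st)=\max(d(s),d(t))$ such that every sequence $(s_i)_{i\in\mathbb N}$ in $\alpha$ on which $d$ is bounded has indices $i<j$ with $s_i\mid s_j$. (Example: the power-products in finitely or countably many indeterminates.) Let $\kappa$ be a non-empty well-ordered set of component-indices. *Terms* are the pairs $t\,e_i$ with $t\in\alpha$, $i\in\kappa$; $s\,e_i$ divides $t\,e_j$ iff $i=j$ and $s\mid t$. Vector-polynomials are finite $K$-linear combinations of terms. Fix a linear order $\preceq$ on $\alpha$ with $1\preceq s$, and $s\preceq t\Rightarrow su\preceq tu$, and a linear order $\preceq_t$ on terms such that $s\,e_i\preceq_t t\,e_j$ implies $us\,e_i\preceq_t ut\,e_j$, and $s\preceq t$, $i\le j$ imply $s\,e_i\preceq_t t\,e_j$. For $p\ne0$ let $\mathrm{lt}(p)$, $\mathrm{lp}(p)$, $\mathrm{lc}(p)$ be the leading term, its power-product, and its coefficient. For a set $F$ of vector-polynomials, $p\to_F q$ means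 that there are $0\neq f\in F$ and $t\in\alpha$ such that the coefficient $c$ of $t\cdot\mathrm{lt}(f)$ in $p$ is non-zero and $q=p-\frac{c}{\mathrm{lc}(f)}\,t f$; $\to_F^*$ is the reflexive-transitive closure. $F$ is a *Gröbner basis* iff $\to_F$ is confluent. $\mathrm{pmdl}(F)$ is the submodule generated by $F$. The S-polynomial $\mathrm{spoly}(p,q)$ is $\frac{l}{\mathrm{lc}(p)\mathrm{lp}(p)}p-\frac{l}{\mathrm{lc}(q)\mathrm{lp}(q)}q$ with $l=\mathrm{lcm}(\mathrm{lp}(p),\mathrm{lp}(q))$ if $\mathrm{lt}(p)$ and $\mathrm{lt}(q)$ have the same component, and $0$ otherwise. **One step of F4.** Let $bs$ be a finite list of vector-polynomials (the current basis) and $sps$ a finite list of pairs of vector-polynomials. * *Symbolic preprocessing*: let $fs$ initially consist of the two polynomials $\frac{l}{\mathrm{lc}(p)\mathrm{lp}(p)}p$ and $\frac{l}{\mathrm{lc}(q)\mathrm{lp}(q)}q$ for each $(p,q)\in sps$, and let $vs$ be the list of terms appearing in them. While $vs$ is non-empty, remove its largest term $v$ from $vs$, and for each non-zero $b\in bs$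 with $\mathrm{lt}(b)\mid v$ add to $fs$ the multiple $t b$ ($t\in\alpha$) with $\mathrm{lt}(tb)=v$, and to $vs$ all terms of $tb$ other than $v$. Return $fs$. * Form the *Macaulay matrix* of $fs$: its rows are the coefficients of the elements of $fs$ at the distinct terms appearing in $fs$, in descending order. Let $\mathrm{f4red}(bs,sps)$ be the list of all non-zero polynomials given by the rows of the reduced row echelon form of that matrix whose leading term is not the leading term of a non-zero element of $fs$. **The algorithm F4.** Let $\mathrm{sel}$ be a function that for all $bs$ and non-empty $ps$ returns a non-empty list $\mathrm{sel}(bs,ps)$ of elements of $ps$, and let $\mathrm{keep}$ be a function such that $\mathrm{keep}(bs,ps,sps)$ is a list of elements of $sps$, and every $(p,q)\in sps$ not in this list satisfies one of: (a) $\mathrm{spoly}(p,q)\to_{bs}^*0$; (b) $\kappa$ has only one element and $\mathrm{lp}(p)$, $\mathrm{lp}(q)$ are relatively prime (product criterion); (c) there is $0\ne r\in bs$ such that $\mathrm{lt}(r)$ divides the term with power-product $\mathrm{lcm}(\mathrm{lp}(p),\mathrm{lp}(q))$ and the component of $\mathrm{lt}(p)$, and $\mathrm{spoly}(p,r)\to_{bs}^*0$,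 $\mathrm{spoly}(r,q)\to_{bs}^*0$ (chain criterion). (Discarding nothing is allowed.) On input of a finite list $bs$, let $ps$ contain exactly one of $(h_1,h_2)$, $(h_2,h_1)$ for any two distinct elements of $bs$. Repeat the following until $ps$ is empty or for every component $i$ appearing in $bs$ there is a non-zero $b\in bs$ with $\mathrm{lt}(b)=1\,e_i$: let $sps=\mathrm{sel}(bs,ps)$, let $ps_0$ be $ps$ without the elements of $sps$, and $hs=\mathrm{f4red}(bs,\mathrm{keep}(bs,ps_0,sps))$; replace $ps$ by the list of all pairs in $ps_0$, all $(h,b)$ with $h\in hs$, $b\in bs$, and one of $(h_1,h_2)$, $(h_2,h_1)$ for any two distinct elements of $hs$; and append $hs$ to $bs$. Finally return $bs$. **Theorem.** 1. Symbolic preprocessing terminates for all $bs$ and $sps$, so $\mathrm{f4red}(bs,sps)$ is well-defined. 2. For all $bs$, $sps$, every $h\in\mathrm{f4red}(bs,sps)$ is non-zero, and $\mathrm{lt}(b)\nmid\mathrm{lt}(h)$ for every non-zero $b\in bs$. 3. If $sps$ consists of pairs of elements of $bs$ and $hs=\mathrm{f4red}(bs,sps)$, then $hs\subseteq\mathrm{pmdl}(bs)$,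 and $\mathrm{spoly}(p,q)\to_{bs\cup hs}^*0$ for all $(p,q)\in sps$. 4. For all $\mathrm{sel}$ and $\mathrm{keep}$ as above and every finite input list $bs$, F4 terminates, and its output $gs$ is a Gröbner basis with $\mathrm{pmdl}(gs)=\mathrm{pmdl}(bs)$. -/

import Mathlib

/-! # The F4 algorithm for submodules of free modules over polynomial rings -/

namespace F4

/-! ## Power-products, terms, term orders -/

/-- Types of abstract power-products: cancellative commutative monoids with least common
multiples, in which `1` is the only invertible element, and which admit a Dickson grading. -/
class GradedDicksonPowerprod (α : Type*) [CancelCommMonoid α] where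
  /-- The least common multiple. -/
  lcm : α → α → α
  dvd_lcm : ∀ s t : α, s ∣ lcm s t
  lcm_dvd : ∀ s t u : α, s ∣ u → t ∣ u → lcm s t ∣ u
  lcm_comm : ∀ s t : α, lcm s t = lcm t s
  mul_eq_one : ∀ s t : α, s * t = 1 → s = 1
  exists_dicksonGrading : ∃ d : α → ℕ, (∀ s t : α, d (s * t) = max (d s) (d t)) ∧
    ∀ (m : ℕ) (s : ℕ → α), (∀ i, d (s i) ≤ m) → ∃ i j : ℕ, i < j ∧ s i ∣ s j

/-- The term `t e_i` with power-product `t` and component-index `i`. -/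
@[ext]
structure Term (α κ : Type*) where
  /-- The power-product. -/
  pp : α
  /-- The component-index. -/
  comp : κ

/-- Multiplication of a term by a power-product. -/
def stimes {α κ : Type*} [Mul α] (t : α) (v : Term α κ) : Term α κ := ⟨t * v.pp, v.comp⟩

/-- Divisibility of terms. -/
def Term.Dvd {α κ : Type*} [CancelCommMonoid α] (u v : Term α κ) : Prop :=
  u.comp = v.comp ∧ u.pp ∣ v.pp

/-- The linear order on `α` is admissible, and the linear order on terms extends it
compatibly. -/
class IsTermOrder (α κ : Type*) [CancelCommMonoid α] [LinearOrder α] [LinearOrder κ]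
    [LinearOrder (Term α κ)] : Prop where
  one_le : ∀ s : α, 1 ≤ s
  mul_le_mul : ∀ s t u : α, s ≤ t → s * u ≤ t * u
  stimes_le_stimes : ∀ (u : α) (v w : Term α κ), v ≤ w → stimes u v ≤ stimes u w
  term_le_term : ∀ v w : Term α κ, v.pp ≤ w.pp → v.comp ≤ w.comp → v ≤ w

open Classical in
/-- The quotient `t / s` of power-products; only used if `s` divides `t`. -/
noncomputable def ppDiv {α : Type*} [CancelCommMonoid α] (t s : α) : α :=
  if h : s ∣ t then h.choose else 1

/-! ## Vector-polynomials -/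

/-- Vector-polynomials: finite `K`-linear combinations of terms. The coefficient of the term `v`
in `p` is `p v`, and the set of terms appearing in `p` is `p.support`. -/
abbrev VPoly (α κ K : Type*) [Field K] := Term α κ →₀ K

section Poly

variable {α κ K : Type*} [CancelCommMonoid α] [Field K]

/-- Multiplication of a vector-polynomial by the monomial `c t`. -/
noncomputable def monomMult (c : K) (t : α) (p : VPoly α κ K) : VPoly α κ K :=
  c • Finsupp.mapDomain (stimes t) p

/-- The submodule generated by `B`: the smallest set that contains `B ∪ {0}` and is closed under
addition and under multiplication by monomials. -/
inductive pmdl (B : Set (VPoly α κ K)) : Set (VPoly α κ K)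
  | zero : pmdl B 0
  | base (b : VPoly α κ K) : b ∈ B → pmdl B b
  | add (p q : VPoly α κ K) : pmdl B p → pmdl B q → pmdl B (p + q)
  | monomMult (c : K) (t : α) (p : VPoly α κ K) : pmdl B p → pmdl B (monomMult c t p)

variable [Nonempty κ] [LinearOrder (Term α κ)]

/-- The leading term of a non-zero polynomial (an arbitrary term for `0`). -/
noncomputable def lt (p : VPoly α κ K) : Term α κ :=
  if h : p.support.Nonempty then p.support.max' h else ⟨1, Classical.arbitrary κ⟩

/-- The leading power-product. -/
noncomputable def lp (p : VPoly α κ K) : α := (lt p).pp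

/-- The leading coefficient. -/
noncomputable def lc (p : VPoly α κ K) : K := p (lt p)

/-- The tail: the polynomial without its leading monomial. -/
noncomputable def tail (p : VPoly α κ K) : VPoly α κ K := p.erase (lt p)

/-! ## Reduction, Gröbner bases, S-polynomials -/

/-- `p` reduces to `q` modulo `f` using `t`. -/
def RedSingle (p q f : VPoly α κ K) (t : α) : Prop :=
  f ≠ 0 ∧ p (stimes t (lt f)) ≠ 0 ∧ q = p - monomMult (p (stimes t (lt f)) / lc f) t f

/-- `p` reduces to `q` modulo the set `F` in one step. -/
def Red (F : Set (VPoly α κ K)) (p q : VPoly α κ K) : Prop :=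
  ∃ f ∈ F, ∃ t : α, RedSingle p q f t

/-- `p` reduces to `q` modulo the set `F` in finitely many steps. -/
def RedStar (F : Set (VPoly α κ K)) : VPoly α κ K → VPoly α κ K → Prop :=
  Relation.ReflTransGen (Red F)

/-- `F` is a Gröbner basis: the reduction relation modulo `F` is confluent. -/
def IsGroebnerBasis (F : Set (VPoly α κ K)) : Prop :=
  ∀ p q₁ q₂ : VPoly α κ K, RedStar F p q₁ → RedStar F p q₂ →
    ∃ r : VPoly α κ K, RedStar F q₁ r ∧ RedStar F q₂ r

variable [GradedDicksonPowerprod α]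

open Classical in
/-- The S-polynomial of `p` and `q`. -/
noncomputable def spoly (p q : VPoly α κ K) : VPoly α κ K :=
  if (lt p).comp = (lt q).comp then
    let l := GradedDicksonPowerprod.lcm (lp p) (lp q)
    monomMult (1 / lc p) (ppDiv l (lp p)) p - monomMult (1 / lc q) (ppDiv l (lp q)) q
  else 0

end Poly

/-! ## Loops -/

open Classical in
/-- The result of `while c do f`, started in state `s`; `none` if the loop does not terminate. -/
noncomputable def whileOption {σ : Type*} (c : σ → Prop) (f : σ → σ) (s : σ) : Option σ :=
  if h : ∃ n : ℕ, ¬ c (f^[n] s) then some (f^[Nat.find h] s) else none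

/-! ## Reduced row echelon form -/

/-- Every matrix over a field is row equivalent to one in reduced row echelon form. -/
theorem exists_reducedRowEchelon {K : Type*} [Field K] {m n : ℕ} (A : Matrix (Fin m) (Fin n) K) :
    ∃ B : Matrix (Fin m) (Fin n) K,
      B.IsReducedRowEchelon ∧ ∃ P : Matrix (Fin m) (Fin m) K, IsUnit P ∧ B = P * A := by
  classical
  have key : ∀ k : ℕ, k ≤ n → ∃ (P : Matrix (Fin m) (Fin m) K) (r : ℕ) (c : ℕ → ℕ),
      IsUnit P ∧ (∀ (i : Fin m) (j : Fin n), r ≤ i → (j : ℕ) < k → (P * A) i j = 0) ∧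
      (∀ i : Fin m, (i : ℕ) < r → c i < k ∧
        (∀ j : Fin n, (j : ℕ) < c i → (P * A) i j = 0) ∧
        ∀ (i' : Fin m) (j : Fin n), (j : ℕ) = c i → (P * A) i' j = if i' = i then 1 else 0) ∧
      ∀ i i' : ℕ, i < i' → i' < r → c i < c i' := by
    intro k
    induction k with
    | zero => exact fun _ => ⟨1, 0, fun _ => 0, isUnit_one, by simp, by simp, by simp⟩
    | succ k ih =>
      intro hk
      obtain ⟨P, r, c, hP, h0, hc, hmono⟩ := ih (by omega)
      by_cases hz : ∀ i : Fin m, r ≤ i → (P * A) i ⟨k, hk⟩ = 0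
      · refine ⟨P, r, c, hP, fun i j hi hj => ?_, fun i hi => ?_, hmono⟩
        · rcases Nat.lt_succ_iff_lt_or_eq.1 hj with h | h
          · exact h0 i j hi h
          · have : j = ⟨k, hk⟩ := Fin.ext h
            rw [this]; exact hz i hi
        · exact ⟨(hc i hi).1.trans k.lt_succ_self, (hc i hi).2⟩
      · push Not at hz
        obtain ⟨i₀, hi₀, hne⟩ := hz
        obtain ⟨q, hq⟩ : ∃ q : Fin m, (q : ℕ) = r := ⟨⟨r, by omega⟩, rfl⟩
        set C : Matrix (Fin m) (Fin n) K := (P * A).submatrix (Equiv.swap q i₀) id with hC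
        have hCne : C q ⟨k, hk⟩ ≠ 0 := by simpa [hC] using hne
        set d := C q ⟨k, hk⟩ with hd
        let w : Fin m → K := fun i => if i = q then d⁻¹ else -(C i ⟨k, hk⟩ * d⁻¹)
        let T : Matrix (Fin m) (Fin m) K := (1 : Matrix (Fin m) (Fin m) K).updateCol q w
        let S : Matrix (Fin m) (Fin m) K := (Equiv.swap q i₀).toPEquiv.toMatrix
        have hT : IsUnit T := by
          rw [Matrix.isUnit_iff_isUnit_det, ← Matrix.cramer_apply, Matrix.cramer_one]
          simpa [w] using hCne
        have hS : IsUnit S := by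
          refine IsUnit.of_mul_eq_one (b := S) ?_
          rw [PEquiv.toMatrix_toPEquiv_mul]
          ext i j
          simp [S, PEquiv.toMatrix_apply, Matrix.one_apply]
        have hSA : S * (P * A) = C := PEquiv.toMatrix_toPEquiv_mul _ _
        have hB : T * S * P * A = T * C := by rw [← hSA]; simp only [Matrix.mul_assoc]
        have hTC : ∀ i j, (T * C) i j =
            if i = q then d⁻¹ * C q j else C i j - C i ⟨k, hk⟩ * d⁻¹ * C q j := by
          intro i j
          have hTe : ∀ x, T i x = (if i = x then 1 else 0) +
              (if x = q then w i - (if i = q then 1 else 0) else 0) := by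
            intro x
            by_cases hx : x = q
            · subst hx; simp [T]
            · simp [T, hx, Matrix.one_apply]
          rw [Matrix.mul_apply]
          simp only [hTe, add_mul, Finset.sum_add_distrib, ite_mul, one_mul, zero_mul,
            Finset.sum_ite_eq, Finset.sum_ite_eq', Finset.mem_univ, if_true]
          by_cases hi : i = q
          · simp [hi, w]; ring
          · simp [hi, w]; ring
        have hCz : ∀ (i : Fin m) (j : Fin n), r ≤ i → (j : ℕ) < k → C i j = 0 := by
          intro i j hi hj
          refine h0 _ _ ?_ hj
          rw [Equiv.swap_apply_def]
          split_ifs <;> omega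
        have hCs : ∀ (i : Fin m) (j : Fin n), (i : ℕ) < r → C i j = (P * A) i j := by
          intro i j hi
          have h1 : i ≠ q := by rintro rfl; omega
          have h2 : i ≠ i₀ := by rintro rfl; omega
          simp [hC, Equiv.swap_apply_of_ne_of_ne h1 h2]
        have hqz : ∀ j : Fin n, (j : ℕ) < k → C q j = 0 := fun j hj => hCz q j hq.ge hj
        refine ⟨T * S * P, r + 1, fun i => if i = r then k else c i, (hT.mul hS).mul hP,
          fun i j hi hj => ?_, fun i hi => ?_, fun i i' hii hi' => ?_⟩
        · have hiq : i ≠ q := by rintro rfl; omega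
          rw [hB, hTC, if_neg hiq]
          rcases Nat.lt_succ_iff_lt_or_eq.1 hj with h | h
          · rw [hqz j h, hCz i j (by omega) h]; simp
          · have : j = ⟨k, hk⟩ := Fin.ext h
            rw [this, ← hd, mul_assoc, inv_mul_cancel₀ hCne]; simp
        · rw [hB]
          by_cases hir : (i : ℕ) = r
          · have hiq : i = q := Fin.ext (hir.trans hq.symm)
            subst hiq
            simp only [hir, if_true]
            refine ⟨k.lt_succ_self, fun j hj => ?_, fun i' j hj => ?_⟩
            · rw [hTC, if_pos rfl, hqz j hj, mul_zero]
            · have : j = ⟨k, hk⟩ := Fin.ext hj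
              rw [this, hTC, ← hd, mul_assoc, inv_mul_cancel₀ hCne]
              simp
          · have hlt : (i : ℕ) < r := by omega
            have hiq : i ≠ q := by rintro rfl; omega
            have hi0 : i ≠ i₀ := by rintro rfl; omega
            obtain ⟨h1, h2, h3⟩ := hc i hlt
            simp only [hir, if_false]
            refine ⟨h1.trans k.lt_succ_self, fun j hj => ?_, fun i' j hj => ?_⟩
            · rw [hTC, if_neg hiq, hqz j (hj.trans h1), hCs i j hlt, h2 j hj]; simp
            · rw [hTC, hqz j (hj ▸ h1)]
              by_cases hi'q : i' = q
              · simp [hi'q, hiq.symm]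
              · have : C i' j = if Equiv.swap q i₀ i' = i then 1 else 0 := h3 _ j hj
                rw [if_neg hi'q, mul_zero, sub_zero, this]
                simp only [Equiv.swap_apply_eq_iff, Equiv.swap_apply_of_ne_of_ne hiq hi0]
        · have hir : i ≠ r := by omega
          simp only [hir, if_false]
          split_ifs with h
          · exact (hc ⟨i, by omega⟩ (by simp; omega)).1
          · exact hmono i i' hii (by omega)
  obtain ⟨P, r, c, hP, h0, hc, hmono⟩ := key n le_rfl
  have hlead : ∀ (i : Fin m) (j : Fin n), (P * A).IsLeadingEntry i j →
      (i : ℕ) < r ∧ (j : ℕ) = c i := by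
    intro i j hl
    have hr : (i : ℕ) < r := by
      by_contra hr
      exact hl.2 (h0 i j (not_lt.1 hr) j.2)
    have h1 : (P * A) i ⟨c i, (hc i hr).1⟩ = 1 := by
      rw [(hc i hr).2.2 i ⟨c i, (hc i hr).1⟩ rfl, if_pos rfl]
    have hl' : (P * A).IsLeadingEntry i ⟨c i, (hc i hr).1⟩ :=
      ⟨fun j' hj' => (hc i hr).2.1 j' hj', by rw [h1]; exact one_ne_zero⟩
    exact ⟨hr, congrArg Fin.val (hl.unique hl')⟩
  refine ⟨P * A, ⟨?_, ?_, ?_⟩, P, hP, rfl⟩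
  · intro i₁ i₂ hlt j₂ hz
    by_cases h2 : (i₂ : ℕ) < r
    · have h1 : (i₁ : ℕ) < r := lt_trans hlt h2
      apply (hc i₂ h2).2.1
      have := hmono _ _ hlt h2
      by_contra hcon
      have hlt' : c i₁ < j₂ := by omega
      have := (hc i₁ h1).2.2 i₁ ⟨c i₁, (hc i₁ h1).1⟩ rfl
      rw [hz _ hlt'] at this
      simp at this
    · exact h0 _ _ (not_lt.1 h2) j₂.2
  · intro i j hl
    obtain ⟨hr, hj⟩ := hlead i j hl
    rw [(hc i hr).2.2 i j hj, if_pos rfl]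
  · intro i₁ i₂ j hlt hl
    obtain ⟨hr, hj⟩ := hlead i₂ j hl
    rw [(hc i₂ hr).2.2 i₁ j hj, if_neg hlt.ne]

/-- The reduced row echelon form of a matrix. -/
noncomputable def rowEchelon {K : Type*} [Field K] {m n : ℕ} (A : Matrix (Fin m) (Fin n) K) :
    Matrix (Fin m) (Fin n) K :=
  (exists_reducedRowEchelon A).choose

/-! ## Macaulay matrices -/

section Algorithm

variable {α κ K : Type*} [CancelCommMonoid α] [Field K] [LinearOrder (Term α κ)]

/-- The list of all distinct terms appearing in `fs`, in descending order. -/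
noncomputable def keysToList (fs : List (VPoly α κ K)) : List (Term α κ) :=
  (fs.foldr (fun (f : VPoly α κ K) (S : Finset (Term α κ)) => f.support ∪ S) ∅).sort
    (fun u v => v ≤ u)

/-- The matrix whose rows are the coefficients of the `fs` at the terms `vs`. -/
def polysToMat (vs : List (Term α κ)) (fs : List (VPoly α κ K)) :
    Matrix (Fin fs.length) (Fin vs.length) K :=
  Matrix.of fun i j => fs.get i (vs.get j)

/-- The list of polynomials whose coefficients at the (distinct) terms `vs` are the rows of `A`. -/
noncomputable def matToPolys {m : ℕ} (vs : List (Term α κ)) (A : Matrix (Fin m) (Fin vs.length) K) :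
    List (VPoly α κ K) :=
  List.ofFn fun i => ∑ j, Finsupp.single (vs.get j) (A i j)

/-- The Macaulay matrix of `fs`. -/
noncomputable def macaulayMat (fs : List (VPoly α κ K)) :
    Matrix (Fin fs.length) (Fin (keysToList fs).length) K :=
  polysToMat (keysToList fs) fs

variable [Nonempty κ]

open Classical in
/-- The non-zero polynomials in the reduced row echelon form of the Macaulay matrix of `fs` whose
leading terms are not among those of `fs`. -/
noncomputable def macaulayRed (fs : List (VPoly α κ K)) : List (VPoly α κ K) :=
  let lts := (fs.filter (fun f => f ≠ 0)).map lt
  (matToPolys (keysToList fs) (rowEchelon (macaulayMat fs))).filter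
    (fun f => f ≠ 0 ∧ lt f ∉ lts)

/-! ## Symbolic preprocessing -/

open Classical in
/-- For every non-zero `b` in `bs` whose leading term divides `v`, add to `fs` the multiple of `b`
with leading power-product that of `v`, and add the terms of its tail to the terms `vs` that
still have to be considered. -/
noncomputable def symPreprocAddnew : List (VPoly α κ K) → List (Term α κ) → List (VPoly α κ K) →
    Term α κ → List (Term α κ) × List (VPoly α κ K)
  | [], vs, fs, _ => (vs, fs)
  | b :: bs, vs, fs, v =>
    if b ≠ 0 ∧ (lt b).Dvd v then
      let f := monomMult 1 (ppDiv v.pp (lp b)) b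
      symPreprocAddnew bs (vs ++ keysToList [tail f]) (if f ∈ fs then fs else f :: fs) v
    else
      symPreprocAddnew bs vs fs v

/-- One iteration of the main loop of symbolic preprocessing: remove the largest term from the
terms `vs` still to be considered, and add the multiples of `bs` needed for reducing it. -/
noncomputable def symPreprocStep (bs : List (VPoly α κ K))
    (s : List (Term α κ) × List (VPoly α κ K)) : List (Term α κ) × List (VPoly α κ K) :=
  match s.1.max? with
  | none => s
  | some v => symPreprocAddnew bs (s.1.filter (fun u => u ≠ v)) s.2 v

variable [GradedDicksonPowerprod α]

/-- The two multiples of `p` and `q` whose difference is the S-polynomial of `p` and `q` if the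
leading terms of `p` and `q` have the same component, for all given pairs `(p, q)`. -/
noncomputable def pairsToList (sps : List (VPoly α κ K × VPoly α κ K)) : List (VPoly α κ K) :=
  sps.flatMap fun x =>
    let l := GradedDicksonPowerprod.lcm (lp x.1) (lp x.2)
    [monomMult (1 / lc x.1) (ppDiv l (lp x.1)) x.1, monomMult (1 / lc x.2) (ppDiv l (lp x.2)) x.2]

/-- Symbolic preprocessing of the pairs `sps` with respect to the basis `bs`
(`none` if the loop does not terminate). -/
noncomputable def symPreproc (bs : List (VPoly α κ K)) (sps : List (VPoly α κ K × VPoly α κ K)) :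
    Option (List (VPoly α κ K)) :=
  (whileOption (fun s => s.1 ≠ []) (symPreprocStep bs)
    (keysToList (pairsToList sps), pairsToList sps)).map Prod.snd

/-- The polynomials that an iteration of F4 with selected pairs `sps` adds to the basis `bs`
(with a dummy value if symbolic preprocessing does not terminate). -/
noncomputable def f4Red (bs : List (VPoly α κ K)) (sps : List (VPoly α κ K × VPoly α κ K)) :
    List (VPoly α κ K) :=
  ((symPreproc bs sps).map macaulayRed).getD []

/-! ## The algorithm schema and F4 -/

/-- For every component-index `i` appearing in `bs` there is a non-zero `b` in `bs` with leading
term `1 e_i`. -/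
def GenWholeModule (bs : List (VPoly α κ K)) : Prop :=
  ∀ b ∈ bs, ∀ v ∈ b.support, ∃ b' ∈ bs, b' ≠ 0 ∧ (lt b').comp = v.comp ∧ lp b' = 1

/-- One of the pairs `(h₁, h₂)`, `(h₂, h₁)` for any two distinct elements of a list without
repetitions. -/
def distinctPairs {β : Type*} : List β → List (β × β)
  | [] => []
  | h :: hs => hs.map (fun h' => (h, h')) ++ distinctPairs hs

open Classical in
/-- The pairs to be considered after `hs` has been added to the basis `bs`. -/
noncomputable def addPairs {β : Type*} (bs : List β) (ps : List (β × β)) (hs : List β) :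
    List (β × β) :=
  ps ++ hs.flatMap (fun h => bs.map fun b => (h, b)) ++ distinctPairs hs.dedup

open Classical in
/-- The elements of the first list that are not in the second one. -/
noncomputable def diffList {β : Type*} (xs ys : List β) : List β :=
  xs.filter (fun x => x ∉ ys)

/-- The main loop of the algorithm schema, with current basis `bs` and list `ps` of pairs still to
be considered (`none` if it does not terminate). -/
noncomputable def gbSchemaAux
    (sel : List (VPoly α κ K) → List (VPoly α κ K × VPoly α κ K) →
      List (VPoly α κ K × VPoly α κ K))
    (compl : List (VPoly α κ K) → List (VPoly α κ K × VPoly α κ K) →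
      List (VPoly α κ K × VPoly α κ K) → List (VPoly α κ K))
    (bs : List (VPoly α κ K)) (ps : List (VPoly α κ K × VPoly α κ K)) :
    Option (List (VPoly α κ K)) :=
  (whileOption (fun s => ¬ (s.2 = [] ∨ GenWholeModule s.1))
    (fun s =>
      let sps := sel s.1 s.2
      let ps₀ := diffList s.2 sps
      let hs := compl s.1 ps₀ sps
      (s.1 ++ hs, addPairs s.1 ps₀ hs))
    (bs, ps)).map Prod.fst

/-- The algorithm schema for computing Gröbner bases. -/
noncomputable def gbSchema
    (sel : List (VPoly α κ K) → List (VPoly α κ K × VPoly α κ K) →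
      List (VPoly α κ K × VPoly α κ K))
    (compl : List (VPoly α κ K) → List (VPoly α κ K × VPoly α κ K) →
      List (VPoly α κ K × VPoly α κ K) → List (VPoly α κ K))
    (bs : List (VPoly α κ K)) : Option (List (VPoly α κ K)) :=
  gbSchemaAux sel compl bs (addPairs [] [] bs)

/-- A pair may be discarded without considering its S-polynomial if that S-polynomial reduces to
`0` modulo the current basis, by the product criterion (for scalar polynomials), or by the chain
criterion. -/
def IsDiscardable (bs : List (VPoly α κ K)) (p q : VPoly α κ K) : Prop :=
  RedStar {b | b ∈ bs} (spoly p q) 0 ∨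
  (Subsingleton κ ∧ IsRelPrime (lp p) (lp q)) ∨
  ∃ r ∈ bs, r ≠ 0 ∧
    (lt r).Dvd ⟨GradedDicksonPowerprod.lcm (lp p) (lp q), (lt p).comp⟩ ∧
    RedStar {b | b ∈ bs} (spoly p r) 0 ∧ RedStar {b | b ∈ bs} (spoly r q) 0

/-- The F4 algorithm: the instance of the algorithm schema where `keep` removes some of the selected
pairs, and `f4Red` is applied to the remaining ones. -/
noncomputable def f4
    (sel : List (VPoly α κ K) → List (VPoly α κ K × VPoly α κ K) →
      List (VPoly α κ K × VPoly α κ K))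
    (keep : List (VPoly α κ K) → List (VPoly α κ K × VPoly α κ K) →
      List (VPoly α κ K × VPoly α κ K) → List (VPoly α κ K × VPoly α κ K))
    (bs : List (VPoly α κ K)) : Option (List (VPoly α κ K)) :=
  gbSchema sel (fun bs ps sps => f4Red bs (keep bs ps sps)) bs

end Algorithm

end F4

open F4

/-!
Every element of a finite set of terms lies in a *Dickson region*: the terms whose components occur
in the set and whose power-products have bounded degree in the Dickson grading. Divisibility is a
well-quasi-order there, hence every term order a well-order, and none of the operations of the
algorithm leaves the region. Symbolic preprocessing terminates because the largest remaining term
decreases, and F4 itself because every iteration either finds a leading term that no element of the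
basis divides or leaves the basis unchanged and removes pairs.

The row space of the Macaulay matrix contains the S-polynomials of the selected pairs. Its leading
terms are those of the rows and of the new polynomials, so that its elements can be reduced to `0`
without leaving it.

For Buchberger's criterion, reduction to `0` of an S-polynomial is weakened to being a combination
of multiples of basis elements with leading terms smaller than the least common multiple of those of
the pair. The product and chain criteria yield this weaker property, and it survives enlarging the
basis.
-/

namespace F4

open Set

/-! ### Terms and Dickson regions -/

section Terms

variable {α κ : Type*} [CancelCommMonoid α]

@[simp]
theorem pp_stimes (t : α) (v : Term α κ) : (stimes t v).pp = t * v.pp := rfl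

@[simp]
theorem stimes_one (v : Term α κ) : stimes 1 v = v :=
  Term.ext (one_mul _) rfl

theorem stimes_stimes (s t : α) (v : Term α κ) : stimes s (stimes t v) = stimes (s * t) v :=
  Term.ext (mul_assoc _ _ _).symm rfl

theorem stimes_injective (t : α) : Function.Injective (stimes t : Term α κ → Term α κ) :=
  fun _ _ h => Term.ext (mul_left_cancel (congrArg Term.pp h)) (congrArg Term.comp h :)

theorem dvd_stimes (t : α) (v : Term α κ) : v.Dvd (stimes t v) :=
  ⟨rfl, dvd_mul_left _ _⟩

theorem ppDiv_mul {s t : α} (h : s ∣ t) : ppDiv t s * s = t := by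
  rw [ppDiv, dif_pos h, mul_comm]
  exact h.choose_spec.symm

theorem stimes_ppDiv {v w : Term α κ} (h : v.Dvd w) : stimes (ppDiv w.pp v.pp) v = w :=
  Term.ext (ppDiv_mul h.2) h.1

/-- Admissible linear orders on terms: multiplication by a power-product is monotone and
increasing. -/
class IsMonomialOrder (α κ : Type*) [Mul α] [LinearOrder (Term α κ)] : Prop where
  stimes_le_stimes : ∀ (t : α) (v w : Term α κ), v ≤ w → stimes t v ≤ stimes t w
  le_stimes : ∀ (t : α) (v : Term α κ), v ≤ stimes t v

instance [LinearOrder α] [LinearOrder κ] [LinearOrder (Term α κ)] [IsTermOrder α κ] :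
    IsMonomialOrder α κ where
  stimes_le_stimes := IsTermOrder.stimes_le_stimes
  le_stimes t v := IsTermOrder.term_le_term _ _
    (by simpa using IsTermOrder.mul_le_mul κ 1 t v.pp (IsTermOrder.one_le κ t)) le_rfl

variable [LinearOrder (Term α κ)] [IsMonomialOrder α κ]

theorem stimes_strictMono (t : α) : StrictMono (stimes t : Term α κ → Term α κ) :=
  Monotone.strictMono_of_injective (IsMonomialOrder.stimes_le_stimes t) (stimes_injective t)

theorem Term.Dvd.le {v w : Term α κ} (h : v.Dvd w) : v ≤ w :=
  stimes_ppDiv h ▸ IsMonomialOrder.le_stimes _ v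

end Terms

section DicksonRegion

variable {α κ : Type*} [CancelCommMonoid α]

/-- A set of terms in which a whole run of the algorithm can take place: divisibility is a
well-quasi-order on it, and it contains the divisors of its elements and all multiples of its
elements by power-products that divide the power-product of one of its elements. -/
structure IsDicksonRegion (B : Set (Term α κ)) : Prop where
  partiallyWellOrderedOn : B.PartiallyWellOrderedOn Term.Dvd
  mem_of_dvd : ∀ ⦃u v : Term α κ⦄, u.Dvd v → v ∈ B → u ∈ B
  stimes_mem : ∀ ⦃t : α⦄ ⦃u v : Term α κ⦄, stimes t u ∈ B → v ∈ B → stimes t v ∈ B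

theorem exists_isDicksonRegion [GradedDicksonPowerprod α] {S : Set (Term α κ)} (hS : S.Finite) :
    ∃ B, IsDicksonRegion B ∧ S ⊆ B := by
  obtain ⟨d, d_mul, dickson⟩ := GradedDicksonPowerprod.exists_dicksonGrading (α := α)
  obtain ⟨m, hm⟩ := (hS.image fun v => d v.pp).bddAbove
  have pp_pwo : {s | d s ≤ m}.PartiallyWellOrderedOn (· ∣ ·) :=
    partiallyWellOrderedOn_iff_exists_lt.2 fun s hs => dickson m s hs
  refine ⟨{v | v.comp ∈ Term.comp '' S ∧ d v.pp ≤ m}, ⟨?_, ?_, ?_⟩,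
    fun v hv => ⟨mem_image_of_mem _ hv, hm (mem_image_of_mem _ hv)⟩⟩
  · refine partiallyWellOrderedOn_iff_exists_lt.2 fun v hv => ?_
    exact (((hS.image Term.comp).partiallyWellOrderedOn (r := (· = ·))).prod pp_pwo).exists_lt
      (f := fun n => ((v n).comp, (v n).pp)) hv
  · rintro u v ⟨hcomp, t, hpp⟩ ⟨hv, hvm⟩
    rw [hpp, d_mul] at hvm
    exact ⟨hcomp ▸ hv, (le_max_left _ _).trans hvm⟩
  · rintro t u v ⟨-, htu⟩ ⟨hv, hvm⟩
    rw [pp_stimes, d_mul] at htu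
    exact ⟨hv, (d_mul t v.pp).trans_le (max_le ((le_max_left _ _).trans htu) hvm)⟩

theorem IsDicksonRegion.stimes_pp_mem {B : Set (Term α κ)} (hB : IsDicksonRegion B)
    {u v : Term α κ} (hu : u ∈ B) (hv : v ∈ B) : stimes u.pp v ∈ B := by
  refine hB.stimes_mem (u := ⟨1, u.comp⟩) ?_ hv
  rwa [show stimes u.pp ⟨1, u.comp⟩ = u from Term.ext (mul_one _) rfl]

theorem IsDicksonRegion.isPWO [LinearOrder (Term α κ)] [IsMonomialOrder α κ]
    {B : Set (Term α κ)} (hB : IsDicksonRegion B) : B.IsPWO :=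
  partiallyWellOrderedOn_iff_exists_lt.2 fun _ hv =>
    let ⟨i, j, hij, h⟩ := hB.partiallyWellOrderedOn.exists_lt hv
    ⟨i, j, hij, h.le⟩

end DicksonRegion

theorem finset_max_lt_max {τ : Type*} [LinearOrder τ] {S T : Finset τ} {v : τ} (hv : v ∈ T)
    (h : ∀ u ∈ S, u < v) : S.max < T.max := by
  refine lt_of_lt_of_le ?_ (Finset.le_max hv)
  rw [Finset.max_eq_sup_coe, Finset.sup_lt_iff (WithBot.bot_lt_coe v)]
  exact fun u hu => WithBot.coe_lt_coe.2 (h u hu)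

theorem induction_on_finset_max {τ X : Type*} [LinearOrder τ] {B : Set τ} (hB : B.IsPWO)
    {I P : X → Prop} (T : X → Finset τ) (hT : ∀ x, I x → (T x : Set τ) ⊆ B)
    (ih : ∀ x, I x → (∀ y, I y → (T y).max < (T x).max → P y) → P x) (x : X) (hx : I x) :
    P x := by
  have wf : (insert ⊥ ((↑) '' B) : Set (WithBot τ)).WellFoundedOn (· < ·) :=
    ((hB.image_of_monotone WithBot.coe_mono).insert ⊥).isWF
  have max_mem (y : X) (hy : I y) : (T y).max ∈ (insert ⊥ ((↑) '' B) : Set (WithBot τ)) := by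
    rcases (T y).eq_empty_or_nonempty with h | h
    · exact .inl (Finset.max_eq_bot.2 h)
    · obtain ⟨v, hv⟩ := Finset.max_of_nonempty h
      exact .inr ⟨v, hT y hy (Finset.mem_of_max hv), hv.symm⟩
  refine wf.induction (P := fun m => ∀ y, I y → (T y).max = m → P y)
    (max_mem x hx) (fun m _ ihm y hy hym => ?_) x hx rfl
  exact ih y hy fun z hz hzy => ihm _ (max_mem z hz) (hym ▸ hzy) z hz rfl

/-! ### Leading terms and reduction -/

theorem mem_supported_Iio {τ K : Type*} [PartialOrder τ] [Semiring K] {p : τ →₀ K} {v : τ}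
    (h : p ∈ Finsupp.supported K K (Iic v)) (hv : p v = 0) : p ∈ Finsupp.supported K K (Iio v) :=
  fun _ hw => (h hw).lt_of_ne fun hwv => Finsupp.mem_support_iff.1 hw (hwv ▸ hv)

section Shift

variable {α κ K : Type*} [CancelCommMonoid α] [Field K]

/-- Multiplication of vector-polynomials by a power-product, as a linear map. -/
noncomputable def shift (t : α) : VPoly α κ K →ₗ[K] VPoly α κ K :=
  Finsupp.lmapDomain K K (stimes t)

theorem monomMult_eq (c : K) (t : α) (p : VPoly α κ K) : monomMult c t p = c • shift t p := rfl

@[simp]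
theorem shift_apply_stimes (t : α) (p : VPoly α κ K) (v : Term α κ) :
    shift t p (stimes t v) = p v :=
  Finsupp.mapDomain_apply (stimes_injective t) p v

@[simp]
theorem shift_one (p : VPoly α κ K) : shift 1 p = p := by
  rw [shift, show (stimes (1 : α) : Term α κ → Term α κ) = id from funext stimes_one,
    Finsupp.lmapDomain_id, LinearMap.id_apply]

theorem shift_shift (s t : α) (p : VPoly α κ K) : shift s (shift t p) = shift (s * t) p := by
  simp only [shift, Finsupp.lmapDomain_apply, ← Finsupp.mapDomain_comp]
  congr 1
  exact funext (stimes_stimes s t)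

theorem shift_ne_zero (t : α) {p : VPoly α κ K} (hp : p ≠ 0) : shift t p ≠ 0 :=
  (map_ne_zero_iff _ (Finsupp.mapDomain_injective (stimes_injective t))).2 hp

theorem shift_mem_supported {t : α} {S T : Set (Term α κ)} (h : MapsTo (stimes t) S T)
    {p : VPoly α κ K} (hp : p ∈ Finsupp.supported K K S) :
    shift t p ∈ Finsupp.supported K K T := by
  have := Submodule.mem_map_of_mem (f := shift t) hp
  rw [shift, Finsupp.lmapDomain_supported] at this
  exact Finsupp.supported_mono h.image_subset this

theorem exists_stimes_eq_of_mem_support_shift {t : α} {p : VPoly α κ K} {w : Term α κ}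
    (hw : w ∈ (shift t p).support) : ∃ v ∈ p.support, stimes t v = w :=
  shift_mem_supported (mapsTo_image _ _) (Finsupp.mem_supported_support K p) hw

theorem IsDicksonRegion.shift_mem_supported {B : Set (Term α κ)} (hB : IsDicksonRegion B) {t : α}
    {v : Term α κ} (hv : stimes t v ∈ B) {p : VPoly α κ K} (hp : p ∈ Finsupp.supported K K B) :
    shift t p ∈ Finsupp.supported K K B :=
  F4.shift_mem_supported (fun _ hu => hB.stimes_mem hv hu) hp

theorem exists_isDicksonRegion_subset_supported [GradedDicksonPowerprod α]
    {F : Set (VPoly α κ K)} (hF : F.Finite) :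
    ∃ B : Set (Term α κ), IsDicksonRegion B ∧ F ⊆ Finsupp.supported K K B :=
  let ⟨B, hB, hFB⟩ := exists_isDicksonRegion (hF.biUnion fun f _ => f.support.finite_toSet)
  ⟨B, hB, fun _ hf => fun _ hv => hFB (mem_biUnion hf hv)⟩

end Shift

section LeadingTerm

variable {α κ K : Type*} [CancelCommMonoid α] [Field K] [Nonempty κ] [LinearOrder (Term α κ)]

theorem lt_mem_support {p : VPoly α κ K} (hp : p ≠ 0) : lt p ∈ p.support := by
  rw [lt, dif_pos (Finsupp.support_nonempty_iff.2 hp)]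
  exact Finset.max'_mem _ _

theorem le_lt {p : VPoly α κ K} {v : Term α κ} (hv : v ∈ p.support) : v ≤ lt p := by
  rw [lt, dif_pos ⟨v, hv⟩]
  exact Finset.le_max' _ _ hv

theorem mem_supported_Iic_lt (p : VPoly α κ K) : p ∈ Finsupp.supported K K (Iic (lt p)) :=
  fun _ => le_lt

theorem lc_ne_zero {p : VPoly α κ K} (hp : p ≠ 0) : lc p ≠ 0 :=
  Finsupp.mem_support_iff.1 (lt_mem_support hp)

theorem lt_eq_of_mem_supported_Iic {p : VPoly α κ K} {v : Term α κ} (hv : p v ≠ 0)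
    (h : p ∈ Finsupp.supported K K (Iic v)) : lt p = v := by
  have hp : p ≠ 0 := by rintro rfl; exact hv rfl
  exact le_antisymm (h (lt_mem_support hp)) (le_lt (Finsupp.mem_support_iff.2 hv))

theorem lp_zero : lp (0 : VPoly α κ K) = 1 := by
  simp [lp, lt]

theorem lt_smul {c : K} (hc : c ≠ 0) {p : VPoly α κ K} (hp : p ≠ 0) : lt (c • p) = lt p :=
  lt_eq_of_mem_supported_Iic (mul_ne_zero hc (lc_ne_zero hp))
    (Submodule.smul_mem _ _ (mem_supported_Iic_lt p))

variable [IsMonomialOrder α κ]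

theorem shift_mem_supported_Iic (t : α) (p : VPoly α κ K) :
    shift t p ∈ Finsupp.supported K K (Iic (stimes t (lt p))) :=
  shift_mem_supported (stimes_strictMono t).monotone.mapsTo_Iic (mem_supported_Iic_lt p)

theorem lt_shift (t : α) {p : VPoly α κ K} (hp : p ≠ 0) : lt (shift t p) = stimes t (lt p) :=
  lt_eq_of_mem_supported_Iic (by rw [shift_apply_stimes]; exact lc_ne_zero hp)
    (shift_mem_supported_Iic t p)

end LeadingTerm

section Reduction

variable {α κ K : Type*} [CancelCommMonoid α] [Field K] [Nonempty κ] [LinearOrder (Term α κ)]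

/-- The result of reducing `p` by the multiple `t f` of `f`: the coefficient of `t * lt f` in `p`
is cancelled. -/
noncomputable def reduceBy (p f : VPoly α κ K) (t : α) : VPoly α κ K :=
  p - (p (stimes t (lt f)) / lc f) • shift t f

theorem red_reduceBy {F : Set (VPoly α κ K)} {p f : VPoly α κ K} {t : α} (hf : f ∈ F)
    (hf0 : f ≠ 0) (ht : stimes t (lt f) ∈ p.support) : Red F p (reduceBy p f t) :=
  ⟨f, hf, t, hf0, Finsupp.mem_support_iff.1 ht, rfl⟩

theorem reduceBy_apply_stimes (p : VPoly α κ K) {f : VPoly α κ K} (hf : f ≠ 0) (t : α) :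
    reduceBy p f t (stimes t (lt f)) = 0 := by
  rw [reduceBy, Finsupp.sub_apply, Finsupp.smul_apply, shift_apply_stimes, smul_eq_mul, ← lc,
    div_mul_cancel₀ _ (lc_ne_zero hf), sub_self]

theorem reduceBy_apply_of_lt [IsMonomialOrder α κ] {p f : VPoly α κ K} {t : α} {w : Term α κ}
    (hw : stimes t (lt f) < w) : reduceBy p f t w = p w := by
  have : shift t f w = 0 :=
    Finsupp.notMem_support_iff.1 fun h => hw.not_ge (shift_mem_supported_Iic t f h)
  rw [reduceBy, Finsupp.sub_apply, Finsupp.smul_apply, this, smul_zero, sub_zero]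

theorem lt_stimes_of_mem_support_reduceBy [IsMonomialOrder α κ] {p f : VPoly α κ K} {t : α}
    (hf : f ≠ 0) {w : Term α κ} (hw : w ∈ (reduceBy p f t).support)
    (hpw : w ∈ p.support → w ≤ stimes t (lt f)) : w < stimes t (lt f) := by
  rw [Finsupp.mem_support_iff] at hw hpw
  rcases lt_trichotomy w (stimes t (lt f)) with h | rfl | h
  · exact h
  · exact absurd (reduceBy_apply_stimes p hf t) hw
  · exact absurd (hpw (reduceBy_apply_of_lt h ▸ hw)) h.not_ge

/-- The term `v` is divisible by the leading term of a non-zero element of `F`. -/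
def IsReducible (F : Set (VPoly α κ K)) (v : Term α κ) : Prop :=
  ∃ f ∈ F, f ≠ 0 ∧ (lt f).Dvd v

theorem isReducible_stimes {F : Set (VPoly α κ K)} {f : VPoly α κ K} (hf : f ∈ F) (hf0 : f ≠ 0)
    (t : α) : IsReducible F (stimes t (lt f)) :=
  ⟨f, hf, hf0, dvd_stimes t _⟩

theorem IsReducible.exists_stimes_eq {F : Set (VPoly α κ K)} {v : Term α κ}
    (h : IsReducible F v) : ∃ f ∈ F, f ≠ 0 ∧ ∃ t : α, stimes t (lt f) = v :=
  let ⟨f, hf, hf0, hfv⟩ := h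
  ⟨f, hf, hf0, _, stimes_ppDiv hfv⟩

theorem exists_redStar_not_isReducible [IsMonomialOrder α κ] {B : Set (Term α κ)}
    (hB : IsDicksonRegion B) {F : Set (VPoly α κ K)} (hF : F ⊆ Finsupp.supported K K B) :
    ∀ p ∈ Finsupp.supported K K B, ∃ r, RedStar F p r ∧ ∀ v ∈ r.support, ¬ IsReducible F v := by
  classical
  refine induction_on_finset_max hB.isPWO
    (fun q => q.support.filter (IsReducible F))
    (fun q hq => (Finset.coe_subset.2 (Finset.filter_subset _ _)).trans hq)
    fun q hq ih => ?_
  rcases (q.support.filter (IsReducible F)).eq_empty_or_nonempty with hirr | hred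
  · exact ⟨q, .refl, fun _ hv => Finset.filter_eq_empty_iff.1 hirr hv⟩
  have hmax := Finset.max'_mem _ hred
  obtain ⟨hv, hvred⟩ := Finset.mem_filter.1 hmax
  obtain ⟨f, hf, hf0, t, ht⟩ := hvred.exists_stimes_eq
  have htq : stimes t (lt f) ∈ q.support := ht ▸ hv
  obtain ⟨r, hr, hr'⟩ := ih (reduceBy q f t)
    (sub_mem hq (Submodule.smul_mem _ _ (hB.shift_mem_supported (hq htq) (hF hf))))
    (finset_max_lt_max hmax fun w hw => ht ▸ lt_stimes_of_mem_support_reduceBy hf0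
      (Finset.mem_filter.1 hw).1 fun hwq =>
        ht ▸ Finset.le_max' _ _ (Finset.mem_filter.2 ⟨hwq, (Finset.mem_filter.1 hw).2⟩))
  exact ⟨r, .head (red_reduceBy hf hf0 htq) hr, hr'⟩

theorem redStar_zero_of_forall_exists_lt_eq [IsMonomialOrder α κ] {B : Set (Term α κ)}
    (hB : IsDicksonRegion B) {F : Set (VPoly α κ K)} {V : Submodule K (VPoly α κ K)}
    (hVB : V ≤ Finsupp.supported K K B)
    (hV : ∀ p ∈ V, p ≠ 0 → ∃ f ∈ F, f ≠ 0 ∧ ∃ t, shift t f ∈ V ∧ stimes t (lt f) = lt p) :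
    ∀ p ∈ V, RedStar F p 0 := by
  refine induction_on_finset_max hB.isPWO Finsupp.support
    (fun q hq => hVB hq) fun q hq ih => ?_
  by_cases hq0 : q = 0
  · exact hq0 ▸ .refl
  obtain ⟨f, hf, hf0, t, htV, ht⟩ := hV q hq hq0
  have htq : stimes t (lt f) ∈ q.support := ht ▸ lt_mem_support hq0
  exact .head (red_reduceBy hf hf0 htq) <| ih (reduceBy q f t)
    (sub_mem hq (Submodule.smul_mem _ _ htV))
    (finset_max_lt_max htq fun w hw =>
      lt_stimes_of_mem_support_reduceBy hf0 hw fun hwq => ht ▸ le_lt hwq)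

end Reduction

/-! ### Spans of multiples and S-polynomials -/

section MultSpan

variable {α κ K : Type*} [CancelCommMonoid α] [Field K] [Nonempty κ] [LinearOrder (Term α κ)]

/-- The linear combinations of those multiples `t f` of elements of `F` whose leading terms
`t * lt f` lie in `S`. -/
noncomputable def multSpan (F : Set (VPoly α κ K)) (S : Set (Term α κ)) :
    Submodule K (VPoly α κ K) :=
  Submodule.span K {g | ∃ f ∈ F, f ≠ 0 ∧ ∃ t : α, stimes t (lt f) ∈ S ∧ shift t f = g}

theorem shift_mem_multSpan {F : Set (VPoly α κ K)} {S : Set (Term α κ)} {f : VPoly α κ K}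
    (hf : f ∈ F) (hf0 : f ≠ 0) {t : α} (ht : stimes t (lt f) ∈ S) : shift t f ∈ multSpan F S :=
  Submodule.subset_span ⟨f, hf, hf0, t, ht, rfl⟩

theorem multSpan_le {F : Set (VPoly α κ K)} {S : Set (Term α κ)} {V : Submodule K (VPoly α κ K)} :
    multSpan F S ≤ V ↔ ∀ f ∈ F, f ≠ 0 → ∀ t, stimes t (lt f) ∈ S → shift t f ∈ V := by
  refine Submodule.span_le.trans ⟨fun h f hf hf0 t ht => h ⟨f, hf, hf0, t, ht, rfl⟩, ?_⟩
  rintro h _ ⟨f, hf, hf0, t, ht, rfl⟩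
  exact h f hf hf0 t ht

theorem multSpan_mono_left {F G : Set (VPoly α κ K)} (h : F ⊆ G) (S : Set (Term α κ)) :
    multSpan F S ≤ multSpan G S :=
  multSpan_le.2 fun _ hf hf0 _ ht => shift_mem_multSpan (h hf) hf0 ht

theorem multSpan_mono_right {F : Set (VPoly α κ K)} {S T : Set (Term α κ)}
    (h : ∀ v ∈ S, IsReducible F v → v ∈ T) : multSpan F S ≤ multSpan F T :=
  multSpan_le.2 fun _ hf hf0 t ht =>
    shift_mem_multSpan hf hf0 (h _ ht (isReducible_stimes hf hf0 t))

theorem mem_multSpan_Iio_of_not_isReducible {F : Set (VPoly α κ K)} {S : Set (Term α κ)}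
    {v : Term α κ} (hv : ¬ IsReducible F v) {p : VPoly α κ K}
    (hp : p ∈ multSpan F (S ∩ Iic v)) : p ∈ multSpan F (S ∩ Iio v) := by
  refine multSpan_mono_right (fun w hw hwF => ?_) hp
  exact ⟨hw.1, hw.2.lt_of_ne fun h => hv (h ▸ hwF)⟩

theorem multSpan_empty (F : Set (VPoly α κ K)) : multSpan F ∅ = ⊥ :=
  le_bot_iff.1 (multSpan_le.2 fun _ _ _ _ ht => absurd ht (notMem_empty _))

theorem shift_mem_multSpan_of_mapsTo {F : Set (VPoly α κ K)} {S T : Set (Term α κ)} {u : α}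
    (h : MapsTo (stimes u) S T) {p : VPoly α κ K} (hp : p ∈ multSpan F S) :
    shift u p ∈ multSpan F T := by
  suffices multSpan F S ≤ (multSpan F T).comap (shift u) from this hp
  refine multSpan_le.2 fun f hf hf0 t ht => ?_
  rw [Submodule.mem_comap, shift_shift]
  exact shift_mem_multSpan hf hf0 (stimes_stimes u t (lt f) ▸ h ht)

theorem exists_finset_mem_multSpan {F : Set (VPoly α κ K)} {S : Set (Term α κ)}
    {p : VPoly α κ K} (hp : p ∈ multSpan F S) :
    ∃ T : Finset (Term α κ), (T : Set (Term α κ)) ⊆ S ∧ p ∈ multSpan F T := by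
  classical
  induction hp using Submodule.span_induction with
  | mem g hg =>
    obtain ⟨f, hf, hf0, t, ht, rfl⟩ := hg
    exact ⟨{stimes t (lt f)}, by simpa using ht, shift_mem_multSpan hf hf0 (by simp)⟩
  | zero => exact ⟨∅, by simp, zero_mem _⟩
  | add p q _ _ hp hq =>
    obtain ⟨T, hTS, hT⟩ := hp
    obtain ⟨U, hUS, hU⟩ := hq
    refine ⟨T ∪ U, by simp [hTS, hUS], add_mem ?_ ?_⟩
    · exact multSpan_mono_right (fun v hv _ => Finset.mem_union_left U hv) hT
    · exact multSpan_mono_right (fun v hv _ => Finset.mem_union_right T hv) hU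
  | smul c p _ hp =>
    obtain ⟨T, hTS, hT⟩ := hp
    exact ⟨T, hTS, Submodule.smul_mem _ c hT⟩

theorem mem_pmdl {F : Set (VPoly α κ K)} {p : VPoly α κ K} :
    p ∈ pmdl F ↔ p ∈ multSpan F univ := by
  constructor
  · intro h
    induction h with
    | zero => exact zero_mem _
    | base b hb =>
      by_cases hb0 : b = 0
      · exact hb0 ▸ zero_mem _
      · exact shift_one b ▸ shift_mem_multSpan hb hb0 (mem_univ _)
    | add p q _ _ hp hq => exact add_mem hp hq
    | monomMult c t p _ hp =>
      exact Submodule.smul_mem _ c (shift_mem_multSpan_of_mapsTo (mapsTo_univ _ _) hp)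
  · intro h
    induction h using Submodule.span_induction with
    | mem g hg =>
      obtain ⟨f, hf, -, t, -, rfl⟩ := hg
      have := pmdl.monomMult 1 t f (.base f hf)
      rwa [monomMult_eq, one_smul] at this
    | zero => exact .zero
    | add p q _ _ hp hq => exact .add p q hp hq
    | smul c p _ hp =>
      have := pmdl.monomMult c 1 p hp
      rwa [monomMult_eq, shift_one] at this

theorem multSpan_univ_le {F G : Set (VPoly α κ K)} (h : ∀ f ∈ F, f ∈ pmdl G) :
    multSpan F univ ≤ multSpan G univ :=
  multSpan_le.2 fun f hf _ _ _ =>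
    shift_mem_multSpan_of_mapsTo (mapsTo_univ _ _) (mem_pmdl.1 (h f hf))

theorem Red.sub_mem_multSpan {F : Set (VPoly α κ K)} {p q : VPoly α κ K} (h : Red F p q)
    {S : Set (Term α κ)} (hp : p ∈ Finsupp.supported K K S) : p - q ∈ multSpan F S := by
  obtain ⟨f, hf, t, hf0, ht, rfl⟩ := h
  rw [sub_sub_cancel]
  exact Submodule.smul_mem _ _ (shift_mem_multSpan hf hf0 (hp (Finsupp.mem_support_iff.2 ht)))

variable [IsMonomialOrder α κ]

theorem multSpan_le_supported (F : Set (VPoly α κ K)) {S : Set (Term α κ)} (hS : IsLowerSet S) :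
    multSpan F S ≤ Finsupp.supported K K S :=
  multSpan_le.2 fun f _ _ t ht _ hw => hS (shift_mem_supported_Iic t f hw) ht

theorem multSpan_inter_le_supported (F : Set (VPoly α κ K)) (S : Set (Term α κ))
    {T : Set (Term α κ)} (hT : IsLowerSet T) : multSpan F (S ∩ T) ≤ Finsupp.supported K K T :=
  (multSpan_mono_right fun _ hv _ => hv.2).trans (multSpan_le_supported F hT)

theorem RedStar.sub_mem_multSpan {F : Set (VPoly α κ K)} {p q : VPoly α κ K} (h : RedStar F p q)
    {S : Set (Term α κ)} (hS : IsLowerSet S) (hp : p ∈ Finsupp.supported K K S) :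
    p - q ∈ multSpan F S := by
  induction h with
  | refl => exact sub_self p ▸ zero_mem _
  | @tail q r _ hqr ih =>
    have hq : q ∈ Finsupp.supported K K S := by
      simpa using sub_mem hp (multSpan_le_supported F hS ih)
    simpa using add_mem ih (hqr.sub_mem_multSpan hq)

end MultSpan

section SPolynomial

variable {α κ K : Type*} [CancelCommMonoid α] [Field K] [Nonempty κ] [LinearOrder (Term α κ)]
  [GradedDicksonPowerprod α]

/-- The least common multiple of the leading terms of two polynomials, provided that these have
the same component; in general the component is that of `lt p`. -/
noncomputable def lcmTerm (p q : VPoly α κ K) : Term α κ :=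
  ⟨GradedDicksonPowerprod.lcm (lp p) (lp q), (lt p).comp⟩

theorem ppDiv_lcmTerm_mul (p q : VPoly α κ K) :
    ppDiv (lcmTerm p q).pp (lp p) * lp p = (lcmTerm p q).pp :=
  ppDiv_mul (GradedDicksonPowerprod.dvd_lcm _ _)

theorem stimes_ppDiv_lcmTerm (p q : VPoly α κ K) :
    stimes (ppDiv (lcmTerm p q).pp (lp p)) (lt p) = lcmTerm p q :=
  Term.ext (ppDiv_lcmTerm_mul p q) rfl

theorem lcmTerm_comm {p q : VPoly α κ K} (h : (lt p).comp = (lt q).comp) :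
    lcmTerm p q = lcmTerm q p :=
  Term.ext (GradedDicksonPowerprod.lcm_comm _ _) h

theorem lcmTerm_dvd {p q : VPoly α κ K} {v : Term α κ} (hp : (lt p).Dvd v) (hq : (lt q).Dvd v) :
    (lcmTerm p q).Dvd v :=
  ⟨hp.1, GradedDicksonPowerprod.lcm_dvd _ _ _ hp.2 hq.2⟩

theorem spoly_eq {p q : VPoly α κ K} (h : (lt p).comp = (lt q).comp) :
    spoly p q = (1 / lc p) • shift (ppDiv (lcmTerm p q).pp (lp p)) p -
      (1 / lc q) • shift (ppDiv (lcmTerm q p).pp (lp q)) q := by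
  rw [← lcmTerm_comm h, spoly, if_pos h]
  rfl

theorem neg_spoly {p q : VPoly α κ K} (h : (lt p).comp = (lt q).comp) :
    -spoly p q = spoly q p := by
  rw [spoly_eq h, spoly_eq h.symm, neg_sub]

theorem exists_shift_spoly {p q : VPoly α κ K} {s t : α}
    (h : stimes s (lt p) = stimes t (lt q)) :
    ∃ u : α, stimes u (lcmTerm p q) = stimes s (lt p) ∧
      shift u (spoly p q) = (1 / lc p) • shift s p - (1 / lc q) • shift t q := by
  have hcomp : (lt p).comp = (lt q).comp := (congrArg Term.comp h :)
  have hdvd := lcmTerm_dvd (dvd_stimes s (lt p)) (h ▸ dvd_stimes t (lt q))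
  refine ⟨_, stimes_ppDiv hdvd, ?_⟩
  set u := ppDiv (stimes s (lt p)).pp (lcmTerm p q).pp
  have hu : u * (lcmTerm p q).pp = s * lp p := ppDiv_mul hdvd.2
  have hp : u * ppDiv (lcmTerm p q).pp (lp p) = s := by
    refine mul_right_cancel (b := lp p) ?_
    rw [mul_assoc, ppDiv_lcmTerm_mul, hu]
  have hq : u * ppDiv (lcmTerm q p).pp (lp q) = t := by
    refine mul_right_cancel (b := lp q) ?_
    rw [mul_assoc, ppDiv_lcmTerm_mul, ← lcmTerm_comm hcomp, hu]
    exact congrArg Term.pp h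
  rw [spoly_eq hcomp, map_sub, map_smul, map_smul, shift_shift, shift_shift, hp, hq]

theorem spoly_mem_supported [IsMonomialOrder α κ] {p q : VPoly α κ K} (hp : p ≠ 0) (hq : q ≠ 0)
    (h : (lt p).comp = (lt q).comp) : spoly p q ∈ Finsupp.supported K K (Iio (lcmTerm p q)) := by
  have hs := stimes_ppDiv_lcmTerm p q
  have ht := (stimes_ppDiv_lcmTerm q p).trans (lcmTerm_comm h).symm
  rw [spoly_eq h]
  set s := ppDiv (lcmTerm p q).pp (lp p)
  set t := ppDiv (lcmTerm q p).pp (lp q)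
  refine mem_supported_Iio (sub_mem ?_ ?_) ?_
  · exact Submodule.smul_mem _ _ (hs ▸ shift_mem_supported_Iic s p)
  · exact Submodule.smul_mem _ _ (ht ▸ shift_mem_supported_Iic t q)
  · have hps : shift s p (lcmTerm p q) = lc p := by rw [← hs, shift_apply_stimes, lc]
    have hqt : shift t q (lcmTerm p q) = lc q := by rw [← ht, shift_apply_stimes, lc]
    simp [hps, hqt, lc_ne_zero hp, lc_ne_zero hq]

/-- The S-polynomial of `p` and `q` is a linear combination of multiples of elements of `F` whose
leading terms lie in `S` and are smaller than the least common multiple of the leading terms of `p`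
and `q`. This is the part of Buchberger's criterion that survives when `F` grows. -/
def IsResolved (F : Set (VPoly α κ K)) (S : Set (Term α κ)) (p q : VPoly α κ K) : Prop :=
  p ≠ 0 → q ≠ 0 → (lt p).comp = (lt q).comp → spoly p q ∈ multSpan F (S ∩ Iio (lcmTerm p q))

theorem IsResolved.mono_left {F G : Set (VPoly α κ K)} (h : F ⊆ G) {S : Set (Term α κ)}
    {p q : VPoly α κ K} (hpq : IsResolved F S p q) : IsResolved G S p q :=
  fun hp hq hcomp => multSpan_mono_left h _ (hpq hp hq hcomp)

theorem IsResolved.mono_right {F : Set (VPoly α κ K)} {S T : Set (Term α κ)} (h : S ⊆ T)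
    {p q : VPoly α κ K} (hpq : IsResolved F S p q) : IsResolved F T p q :=
  fun hp hq hcomp => multSpan_mono_right
    (fun _ hv _ => inter_subset_inter_left _ h hv) (hpq hp hq hcomp)

theorem IsResolved.symm {F : Set (VPoly α κ K)} {S : Set (Term α κ)} {p q : VPoly α κ K}
    (h : IsResolved F S p q) : IsResolved F S q p := fun hq hp hcomp => by
  rw [lcmTerm_comm hcomp, ← neg_spoly hcomp.symm]
  exact neg_mem (h hp hq hcomp.symm)

theorem isResolved_self (F : Set (VPoly α κ K)) (S : Set (Term α κ)) (p : VPoly α κ K) :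
    IsResolved F S p p := fun _ _ _ => by
  rw [spoly_eq rfl, sub_self]
  exact zero_mem _

theorem IsResolved.exists_finset {F : Set (VPoly α κ K)} {S : Set (Term α κ)}
    {p q : VPoly α κ K} (h : IsResolved F S p q) :
    ∃ T : Finset (Term α κ), IsResolved F T p q := by
  by_cases hpq : p ≠ 0 ∧ q ≠ 0 ∧ (lt p).comp = (lt q).comp
  · obtain ⟨T, hTS, hT⟩ := exists_finset_mem_multSpan (h hpq.1 hpq.2.1 hpq.2.2)
    refine ⟨T, fun _ _ _ => multSpan_mono_right (fun v hv _ => ?_) hT⟩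
    exact ⟨hv, (hTS hv).2⟩
  · exact ⟨∅, fun hp hq hcomp => absurd ⟨hp, hq, hcomp⟩ hpq⟩

theorem isResolved_of_redStar [IsMonomialOrder α κ] {F : Set (VPoly α κ K)} {p q : VPoly α κ K}
    (h : RedStar F (spoly p q) 0) : IsResolved F univ p q := fun hp hq hcomp => by
  simpa using h.sub_mem_multSpan (isLowerSet_Iio _) (spoly_mem_supported hp hq hcomp)

end SPolynomial

/-! ### Buchberger's criterion -/

section Buchberger

variable {α κ K : Type*} [CancelCommMonoid α] [Field K] [Nonempty κ] [LinearOrder (Term α κ)]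
  [IsMonomialOrder α κ] [GradedDicksonPowerprod α] {B : Set (Term α κ)} {F : Set (VPoly α κ K)}

theorem multSpan_Iic_le_sup_span (hB : IsDicksonRegion B)
    (hF : ∀ p ∈ F, ∀ q ∈ F, IsResolved F B p q) {f₀ : VPoly α κ K} (hf₀ : f₀ ∈ F) (hf₀0 : f₀ ≠ 0)
    {t₀ : α} (ht₀ : stimes t₀ (lt f₀) ∈ B) :
    multSpan F (B ∩ Iic (stimes t₀ (lt f₀))) ≤
      multSpan F (B ∩ Iio (stimes t₀ (lt f₀))) ⊔ K ∙ shift t₀ f₀ := by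
  refine multSpan_le.2 fun f hf hf0 t ht => ?_
  rcases ht.2.lt_or_eq with hlt | heq
  · exact Submodule.mem_sup_left (shift_mem_multSpan hf hf0 ⟨ht.1, hlt⟩)
  obtain ⟨u, hu, hspoly⟩ := exists_shift_spoly heq
  rw [heq] at hu
  have hmaps : MapsTo (stimes u) (B ∩ Iio (lcmTerm f f₀)) (B ∩ Iio (stimes t₀ (lt f₀))) :=
    fun w hw => ⟨hB.stimes_mem (hu ▸ ht₀) hw.1, hu ▸ stimes_strictMono u hw.2⟩
  have hmem := shift_mem_multSpan_of_mapsTo hmaps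
    (hF f hf f₀ hf₀ hf0 hf₀0 (congrArg Term.comp heq :))
  have hsplit : shift t f =
      lc f • shift u (spoly f f₀) + (lc f * (1 / lc f₀)) • shift t₀ f₀ := by
    rw [hspoly, smul_sub, smul_smul, smul_smul, mul_one_div_cancel (lc_ne_zero hf0), one_smul,
      sub_add_cancel]
  rw [hsplit]
  exact Submodule.add_mem_sup (Submodule.smul_mem _ _ hmem)
    (Submodule.smul_mem _ _ (Submodule.mem_span_singleton_self _))

theorem mem_multSpan_Iio (hB : IsDicksonRegion B) (hF : ∀ p ∈ F, ∀ q ∈ F, IsResolved F B p q)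
    {v : Term α κ} (hv : v ∈ B) {p : VPoly α κ K} (hp : p ∈ multSpan F (B ∩ Iic v))
    (hpv : p v = 0) : p ∈ multSpan F (B ∩ Iio v) := by
  by_cases hred : IsReducible F v
  · obtain ⟨f₀, hf₀, hf₀0, t₀, rfl⟩ := hred.exists_stimes_eq
    obtain ⟨q, hq, r, hr, rfl⟩ :=
      Submodule.mem_sup.1 (multSpan_Iic_le_sup_span hB hF hf₀ hf₀0 hv hp)
    obtain ⟨c, rfl⟩ := Submodule.mem_span_singleton.1 hr
    have hqv : q (stimes t₀ (lt f₀)) = 0 := Finsupp.notMem_support_iff.1 fun h =>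
      lt_irrefl _ (multSpan_inter_le_supported F B (isLowerSet_Iio _) hq h)
    have hc : c = 0 := by
      rw [Finsupp.add_apply, hqv, zero_add, Finsupp.smul_apply, shift_apply_stimes] at hpv
      exact (mul_eq_zero.1 hpv).resolve_right (lc_ne_zero hf₀0)
    rwa [hc, zero_smul, add_zero]
  · exact mem_multSpan_Iio_of_not_isReducible hred hp

theorem isReducible_lt_of_mem_multSpan_finset (hB : IsDicksonRegion B)
    (hF : ∀ p ∈ F, ∀ q ∈ F, IsResolved F B p q) : ∀ T : Finset (Term α κ), (T : Set _) ⊆ B →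
      ∀ p ∈ multSpan F T, p ≠ 0 → IsReducible F (lt p) := by
  refine induction_on_finset_max hB.isPWO id (fun _ hT => hT) fun T hT ih p hp hp0 => ?_
  have hne : T.Nonempty := by
    rw [Finset.nonempty_iff_ne_empty]
    rintro rfl
    rw [Finset.coe_empty, multSpan_empty] at hp
    exact hp0 hp
  have hmax := T.max'_mem hne
  have hp : p ∈ multSpan F (B ∩ Iic (T.max' hne)) :=
    multSpan_mono_right (fun w hw _ => mem_inter (hT hw) (T.le_max' w hw)) hp
  by_cases hpv : p (T.max' hne) = 0
  · obtain ⟨U, hU, hpU⟩ := exists_finset_mem_multSpan (mem_multSpan_Iio hB hF (hT hmax) hp hpv)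
    exact ih U (hU.trans inter_subset_left) (finset_max_lt_max hmax fun u hu => (hU hu).2) p hpU hp0
  · rw [lt_eq_of_mem_supported_Iic hpv (multSpan_inter_le_supported F B (isLowerSet_Iic _) hp)]
    by_contra hred
    exact lt_irrefl _ (multSpan_inter_le_supported F B (isLowerSet_Iio _)
      (mem_multSpan_Iio_of_not_isReducible hred hp) (Finsupp.mem_support_iff.2 hpv))

theorem isReducible_lt_of_isResolved (hfin : F.Finite)
    (hF : ∀ p ∈ F, ∀ q ∈ F, IsResolved F univ p q) {p : VPoly α κ K}
    (hp : p ∈ multSpan F univ) (hp0 : p ≠ 0) : IsReducible F (lt p) := by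
  obtain ⟨T, -, hT⟩ := exists_finset_mem_multSpan hp
  choose U hU using fun x : F × F => (hF _ x.1.2 _ x.2.2).exists_finset
  have := hfin.to_subtype
  obtain ⟨B, hB, hUB⟩ := exists_isDicksonRegion
    ((finite_iUnion fun x => (U x).finite_toSet).union T.finite_toSet)
  rw [union_subset_iff, iUnion_subset_iff] at hUB
  exact isReducible_lt_of_mem_multSpan_finset hB
    (fun q hq r hr => (hU (⟨q, hq⟩, ⟨r, hr⟩)).mono_right (hUB.1 _)) T hUB.2 p hT hp0

theorem isGroebnerBasis_of_isReducible_lt (hfin : F.Finite)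
    (hF : ∀ p ∈ multSpan F univ, p ≠ 0 → IsReducible F (lt p)) : IsGroebnerBasis F := by
  classical
  intro p q₁ q₂ h₁ h₂
  obtain ⟨B, hB, hFB⟩ := exists_isDicksonRegion_subset_supported ((hfin.insert q₁).insert q₂)
  have normal_form (q : VPoly α κ K) (hq : q ∈ insert q₂ (insert q₁ F)) :=
    exists_redStar_not_isReducible hB (fun f hf => hFB (.inr (.inr hf))) q (hFB hq)
  obtain ⟨r₁, hr₁, hirr₁⟩ := normal_form q₁ (.inr (.inl rfl))
  obtain ⟨r₂, hr₂, hirr₂⟩ := normal_form q₂ (.inl rfl)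
  suffices r₁ = r₂ from ⟨r₁, hr₁, this ▸ hr₂⟩
  have sub_mem_span {r : VPoly α κ K} (h : RedStar F p r) : p - r ∈ multSpan F univ :=
    h.sub_mem_multSpan isLowerSet_univ (subset_univ _)
  have hsub : r₁ - r₂ ∈ multSpan F univ := by
    simpa using sub_mem (sub_mem_span (h₂.trans hr₂)) (sub_mem_span (h₁.trans hr₁))
  by_contra hne
  have hne := sub_ne_zero.2 hne
  have hred := hF _ hsub hne
  rcases Finset.mem_union.1 (Finsupp.support_sub (lt_mem_support hne)) with h | h
  · exact hirr₁ _ h hred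
  · exact hirr₂ _ h hred

end Buchberger

section WholeModule

variable {α κ K : Type*} [CancelCommMonoid α] [Field K] [Nonempty κ] [LinearOrder (Term α κ)]

theorem exists_comp_eq_of_mem_support {F : Set (VPoly α κ K)} {p : VPoly α κ K}
    (hp : p ∈ multSpan F univ) {v : Term α κ} (hv : v ∈ p.support) :
    ∃ f ∈ F, ∃ w ∈ f.support, w.comp = v.comp := by
  have hle : multSpan F univ ≤
      Finsupp.supported K K {v | ∃ f ∈ F, ∃ w ∈ f.support, w.comp = v.comp} := by
    refine multSpan_le.2 fun f hf _ t _ v hv => ?_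
    obtain ⟨w, hw, rfl⟩ := exists_stimes_eq_of_mem_support_shift hv
    exact ⟨f, hf, w, hw, rfl⟩
  exact hle hp hv

theorem GenWholeModule.isReducible {bs : List (VPoly α κ K)} (h : GenWholeModule bs)
    {p : VPoly α κ K} (hp : p ∈ multSpan {b | b ∈ bs} univ) {v : Term α κ} (hv : v ∈ p.support) :
    IsReducible {b | b ∈ bs} v := by
  obtain ⟨b, hb, w, hw, hwv⟩ := exists_comp_eq_of_mem_support hp hv
  obtain ⟨f, hf, hf0, hfw, hlp⟩ := h b hb w hw
  exact ⟨f, hf, hf0, hfw.trans hwv, hlp.dvd.trans (one_dvd v.pp)⟩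

end WholeModule

section Criteria

variable {α κ K : Type*} [CancelCommMonoid α]

theorem stimes_pp_comm [Subsingleton κ] (v w : Term α κ) : stimes v.pp w = stimes w.pp v :=
  Term.ext (mul_comm _ _) (Subsingleton.elim _ _)

theorem lcm_eq_mul_of_isRelPrime [GradedDicksonPowerprod α] {s t : α} (h : IsRelPrime s t) :
    GradedDicksonPowerprod.lcm s t = s * t := by
  obtain ⟨u, hu⟩ := GradedDicksonPowerprod.lcm_dvd s t (s * t) (dvd_mul_right s t)
    (dvd_mul_left t s)
  obtain ⟨a, ha⟩ := GradedDicksonPowerprod.dvd_lcm s t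
  obtain ⟨b, hb⟩ := GradedDicksonPowerprod.dvd_lcm t s
  rw [GradedDicksonPowerprod.lcm_comm] at hb
  have ut : u ∣ t := ⟨a, mul_left_cancel (a := s) (by rw [hu, ha]; ac_rfl)⟩
  have us : u ∣ s := ⟨b, mul_left_cancel (a := t) (by rw [mul_comm, hu, hb]; ac_rfl)⟩
  obtain ⟨v, hv⟩ := (h us ut).exists_right_inv
  rw [hu, GradedDicksonPowerprod.mul_eq_one u v hv, mul_one]

variable [Field K]

/-- The product `g f` of the scalar polynomial given by the coefficients of `g` and the
vector-polynomial `f`; the component-indices of the terms of `g` are ignored. -/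
noncomputable def scalarMul (g f : VPoly α κ K) : VPoly α κ K :=
  g.sum fun v c => c • shift v.pp f

theorem scalarMul_comm [Subsingleton κ] (f g : VPoly α κ K) : scalarMul f g = scalarMul g f := by
  have expand (f g : VPoly α κ K) : scalarMul f g =
      f.sum fun v c => g.sum fun w e => Finsupp.single (stimes v.pp w) (c * e) := by
    refine Finsupp.sum_congr fun v _ => ?_
    simp only [shift, Finsupp.lmapDomain_apply, Finsupp.mapDomain, Finsupp.smul_sum,
      Finsupp.smul_single, smul_eq_mul]
  rw [expand, expand, Finsupp.sum_comm]
  refine Finsupp.sum_congr fun w _ => Finsupp.sum_congr fun v _ => ?_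
  rw [mul_comm, stimes_pp_comm]

variable [Nonempty κ] [LinearOrder (Term α κ)] [IsMonomialOrder α κ]

theorem scalarMul_sub_mem_multSpan [Subsingleton κ] {F : Set (VPoly α κ K)} {f : VPoly α κ K}
    (hf : f ∈ F) (hf0 : f ≠ 0) {g : VPoly α κ K} (hg0 : g ≠ 0) :
    scalarMul g f - lc g • shift (lp g) f ∈ multSpan F (Iio (stimes (lp g) (lt f))) := by
  classical
  rw [scalarMul, Finsupp.sum, ← Finset.add_sum_erase _ _ (lt_mem_support hg0), lc, lp,
    add_sub_cancel_left]
  refine Submodule.sum_mem _ fun v hv => Submodule.smul_mem _ _ (shift_mem_multSpan hf hf0 ?_)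
  obtain ⟨hne, hv⟩ := Finset.mem_erase.1 hv
  rw [mem_Iio, stimes_pp_comm v, stimes_pp_comm (lt g)]
  exact stimes_strictMono _ ((le_lt hv).lt_of_ne hne)

variable [GradedDicksonPowerprod α]

theorem isResolved_of_isRelPrime [Subsingleton κ] {F : Set (VPoly α κ K)} {p q : VPoly α κ K}
    (hpF : p ∈ F) (hqF : q ∈ F) (h : IsRelPrime (lp p) (lp q)) : IsResolved F univ p q := by
  intro hp hq _
  have hpq : stimes (lp q) (lt p) = stimes (lp p) (lt q) := stimes_pp_comm _ _
  have hlcm : lcmTerm p q = stimes (lp q) (lt p) :=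
    Term.ext ((lcm_eq_mul_of_isRelPrime h).trans (mul_comm _ _)) rfl
  obtain ⟨u, hu, hspoly⟩ := exists_shift_spoly hpq
  have hu1 : u = 1 := by
    rw [← hlcm] at hu
    exact mul_eq_right.1 (congrArg Term.pp hu)
  rw [hu1, shift_one] at hspoly
  have hqp_mem := scalarMul_sub_mem_multSpan hpF hp hq
  have hpq_mem := scalarMul_sub_mem_multSpan hqF hq hp
  rw [← hpq, scalarMul_comm] at hpq_mem
  have hdiff : spoly p q = ((lc p)⁻¹ * (lc q)⁻¹) •
      ((scalarMul q p - lc p • shift (lp p) q) - (scalarMul q p - lc q • shift (lp q) p)) := by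
    rw [hspoly, sub_sub_sub_cancel_left, smul_sub, smul_smul, smul_smul, mul_assoc,
      inv_mul_cancel₀ (lc_ne_zero hq), mul_right_comm, inv_mul_cancel₀ (lc_ne_zero hp), mul_one,
      one_mul, one_div, one_div]
  rw [hdiff, univ_inter, hlcm]
  exact Submodule.smul_mem _ _ (sub_mem hpq_mem hqp_mem)

theorem isResolved_of_dvd_lcmTerm {F : Set (VPoly α κ K)} {p q r : VPoly α κ K} (hr0 : r ≠ 0)
    (hr : (lt r).Dvd (lcmTerm p q)) (hpr : IsResolved F univ p r) (hrq : IsResolved F univ r q) :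
    IsResolved F univ p q := by
  intro hp hq hcomp
  obtain ⟨t, ht⟩ : ∃ t, stimes t (lt r) = lcmTerm p q := ⟨_, stimes_ppDiv hr⟩
  have hs := stimes_ppDiv_lcmTerm p q
  have hw := (stimes_ppDiv_lcmTerm q p).trans (lcmTerm_comm hcomp).symm
  obtain ⟨u₁, hu₁, h₁⟩ := exists_shift_spoly (hs.trans ht.symm)
  obtain ⟨u₂, hu₂, h₂⟩ := exists_shift_spoly (ht.trans hw.symm)
  have hsum : spoly p q = shift u₁ (spoly p r) + shift u₂ (spoly r q) := by
    rw [h₁, h₂, spoly_eq hcomp, sub_add_sub_cancel]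
  rw [hsum, univ_inter]
  have shift_mem {u : α} {f g : VPoly α κ K} (hu : stimes u (lcmTerm f g) = lcmTerm p q)
      (hfg : spoly f g ∈ multSpan F (univ ∩ Iio (lcmTerm f g))) :
      shift u (spoly f g) ∈ multSpan F (Iio (lcmTerm p q)) :=
    shift_mem_multSpan_of_mapsTo (fun v hv => hu ▸ stimes_strictMono u hv.2) hfg
  exact add_mem (shift_mem (hu₁.trans hs) (hpr hp hr0 hr.1.symm))
    (shift_mem (hu₂.trans ht) (hrq hr0 hq (hr.1.trans hcomp)))

theorem IsDiscardable.isResolved {bs : List (VPoly α κ K)} {p q : VPoly α κ K} (hp : p ∈ bs)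
    (hq : q ∈ bs) (h : IsDiscardable bs p q) : IsResolved {b | b ∈ bs} univ p q := by
  rcases h with h | ⟨_, h⟩ | ⟨r, -, hr0, hr, hpr, hrq⟩
  · exact isResolved_of_redStar h
  · exact isResolved_of_isRelPrime hp hq h
  · exact isResolved_of_dvd_lcmTerm hr0 hr (isResolved_of_redStar hpr) (isResolved_of_redStar hrq)

end Criteria

/-! ### Macaulay matrices and symbolic preprocessing -/

section Macaulay

theorem exists_lt_eq_of_mem_span {α κ K ι : Type*} [CancelCommMonoid α] [Field K] [Nonempty κ]
    [LinearOrder (Term α κ)] [Finite ι] {g : ι → VPoly α κ K}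
    (hg : ∀ i j, g i ≠ 0 → g j ≠ 0 → lt (g i) = lt (g j) → i = j) {h : VPoly α κ K}
    (hh : h ∈ Submodule.span K (range g)) (h0 : h ≠ 0) : ∃ i, g i ≠ 0 ∧ lt (g i) = lt h := by
  classical
  have := Fintype.ofFinite ι
  obtain ⟨c, rfl⟩ := (Submodule.mem_span_range_iff_exists_fun K).1 hh
  obtain ⟨i, hi, hmax⟩ : ∃ i, c i • g i ≠ 0 ∧ ∀ j, c j • g j ≠ 0 → lt (g j) ≤ lt (g i) := by
    obtain ⟨k, -, hk⟩ := Finset.exists_ne_zero_of_sum_ne_zero h0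
    simpa using Finset.exists_max_image (Finset.univ.filter fun i => c i • g i ≠ 0)
      (fun i => lt (g i)) ⟨k, by simpa using hk⟩
  obtain ⟨hci, hgi⟩ := smul_ne_zero_iff.1 hi
  refine ⟨i, hgi, (lt_eq_of_mem_supported_Iic ?_ (Submodule.sum_mem _ fun j _ => ?_)).symm⟩
  · rw [Finsupp.finsetSum_apply,
      Finset.sum_eq_single_of_mem i (Finset.mem_univ i) fun j _ hji => ?_]
    · exact mul_ne_zero hci (lc_ne_zero hgi)
    by_contra hne
    have hcg : c j • g j ≠ 0 := fun h => hne (DFunLike.congr_fun h _)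
    have hgj := (smul_ne_zero_iff.1 hcg).2
    refine hji (hg j i hgj hgi ((hmax j hcg).antisymm (le_lt ?_)))
    exact Finsupp.mem_support_iff.2 (right_ne_zero_of_mul hne)
  · by_cases hcg : c j • g j = 0
    · exact hcg ▸ zero_mem _
    · exact Submodule.smul_mem _ _ (Finsupp.supported_mono (Iic_subset_Iic.2 (hmax j hcg))
        (mem_supported_Iic_lt (g j)))

theorem range_vecMulLinear_mul_of_isUnit {K : Type*} [Field K] {m n : ℕ}
    {P : Matrix (Fin m) (Fin m) K} (hP : IsUnit P) (A : Matrix (Fin m) (Fin n) K) :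
    LinearMap.range (P * A).vecMulLinear = LinearMap.range A.vecMulLinear := by
  have hcomp : (P * A).vecMulLinear = A.vecMulLinear ∘ₗ P.vecMulLinear :=
    LinearMap.ext fun r => (Matrix.vecMul_vecMul r P A).symm
  rw [hcomp, LinearMap.range_comp_of_range_eq_top]
  exact LinearMap.range_eq_top.2 (Matrix.vecMul_surjective_iff_isUnit.2 hP)

theorem rowEchelon_isReducedRowEchelon {K : Type*} [Field K] {m n : ℕ}
    (A : Matrix (Fin m) (Fin n) K) : (rowEchelon A).IsReducedRowEchelon :=
  (exists_reducedRowEchelon A).choose_spec.1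

theorem range_vecMulLinear_rowEchelon {K : Type*} [Field K] {m n : ℕ}
    (A : Matrix (Fin m) (Fin n) K) :
    LinearMap.range (rowEchelon A).vecMulLinear = LinearMap.range A.vecMulLinear := by
  obtain ⟨P, hP, hPA⟩ := (exists_reducedRowEchelon A).choose_spec.2
  rw [rowEchelon, hPA, range_vecMulLinear_mul_of_isUnit hP]

variable {α κ K : Type*} [Field K]

/-- The polynomial whose coefficients at the terms `vs` are given by a row vector, as a linear
map. -/
noncomputable def rowPoly (vs : List (Term α κ)) : (Fin vs.length → K) →ₗ[K] VPoly α κ K :=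
  Finsupp.lmapDomain K K vs.get ∘ₗ (Finsupp.linearEquivFunOnFinite K K (Fin vs.length)).symm

theorem rowPoly_get {vs : List (Term α κ)} (hvs : Function.Injective vs.get)
    (r : Fin vs.length → K) (j : Fin vs.length) : rowPoly vs r (vs.get j) = r j :=
  Finsupp.mapDomain_apply hvs _ j

theorem rowPoly_mem_supported {vs : List (Term α κ)} {S : Set (Fin vs.length)}
    {r : Fin vs.length → K} (h : ∀ j ∉ S, r j = 0) :
    rowPoly vs r ∈ Finsupp.supported K K (vs.get '' S) := by
  rw [← Finsupp.lmapDomain_supported]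
  exact Submodule.mem_map_of_mem fun j hj => by_contra fun hjS =>
    Finsupp.mem_support_iff.1 hj (h j hjS)

theorem matToPolys_eq {m : ℕ} (vs : List (Term α κ)) (A : Matrix (Fin m) (Fin vs.length) K) :
    matToPolys vs A = List.ofFn fun i => rowPoly vs (A i) := by
  refine congrArg List.ofFn (funext fun i => ?_)
  simp [rowPoly, Finsupp.mapDomain, Finsupp.sum_fintype]

theorem span_matToPolys {m : ℕ} (vs : List (Term α κ)) (A : Matrix (Fin m) (Fin vs.length) K) :
    Submodule.span K {g | g ∈ matToPolys vs A} =
      (LinearMap.range A.vecMulLinear).map (rowPoly vs) := by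
  rw [range_vecMulLinear, Submodule.map_span, ← range_comp]
  simp only [matToPolys_eq, List.mem_ofFn]
  rfl

variable [LinearOrder (Term α κ)]

theorem mem_keysToList {fs : List (VPoly α κ K)} {v : Term α κ} :
    v ∈ keysToList fs ↔ ∃ f ∈ fs, v ∈ f.support := by
  rw [keysToList, Finset.mem_sort]
  induction fs with
  | nil => simp
  | cons f fs ih => rw [List.foldr_cons, Finset.mem_union, ih, List.exists_mem_cons_iff]

theorem strictAnti_get_keysToList (fs : List (VPoly α κ K)) : StrictAnti (keysToList fs).get :=
  fun i j hij => List.pairwise_iff_get.1 (Finset.sortedGT_sort _).pairwise i j hij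

theorem matToPolys_macaulayMat (fs : List (VPoly α κ K)) :
    matToPolys (keysToList fs) (macaulayMat fs) = fs := by
  have hrow (i : Fin fs.length) : rowPoly (keysToList fs) (macaulayMat fs i) = fs.get i := by
    have hvs := (strictAnti_get_keysToList fs).injective
    ext v
    by_cases hv : v ∈ range (keysToList fs).get
    · obtain ⟨j, rfl⟩ := hv
      exact rowPoly_get hvs _ j
    · have hnot : (fs.get i) v = 0 := Finsupp.notMem_support_iff.1 fun h => hv <| by
        rw [range_list_get]
        exact mem_keysToList.2 ⟨_, fs.get_mem i, h⟩
      rw [hnot]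
      exact Finsupp.mapDomain_of_notMem_range _ v hv
  rw [matToPolys_eq, funext hrow, List.ofFn_get]

theorem span_matToPolys_rowEchelon (fs : List (VPoly α κ K)) :
    Submodule.span K {g | g ∈ matToPolys (keysToList fs) (rowEchelon (macaulayMat fs))} =
      Submodule.span K {f | f ∈ fs} := by
  rw [span_matToPolys, range_vecMulLinear_rowEchelon, ← span_matToPolys, matToPolys_macaulayMat]

variable [CancelCommMonoid α] [Nonempty κ]

theorem lt_rowPoly_of_isLeadingEntry {m : ℕ} {vs : List (Term α κ)} (hvs : StrictAnti vs.get)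
    {A : Matrix (Fin m) (Fin vs.length) K} {i : Fin m} {j : Fin vs.length}
    (h : A.IsLeadingEntry i j) : lt (rowPoly vs (A i)) = vs.get j := by
  refine lt_eq_of_mem_supported_Iic ((rowPoly_get hvs.injective _ j).trans_ne h.2) ?_
  have himage : vs.get '' Ici j ⊆ Iic (vs.get j) := hvs.antitone.image_Ici_subset
  exact Finsupp.supported_mono himage (rowPoly_mem_supported fun k hk => h.1 k (not_le.1 hk))

theorem lt_rowPoly_injOn {m : ℕ} {vs : List (Term α κ)} (hvs : StrictAnti vs.get)
    {A : Matrix (Fin m) (Fin vs.length) K} (hA : A.IsReducedRowEchelon) (i k : Fin m)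
    (hi : rowPoly vs (A i) ≠ 0) (hk : rowPoly vs (A k) ≠ 0)
    (hik : lt (rowPoly vs (A i)) = lt (rowPoly vs (A k))) : i = k := by
  have exists_lead (i : Fin m) (h : rowPoly vs (A i) ≠ 0) : ∃ j, A.IsLeadingEntry i j :=
    Matrix.row_ne_zero_iff_exists_isLeadingEntry.1 fun h0 =>
      h ((congrArg (rowPoly vs) h0).trans (map_zero _))
  obtain ⟨a, ha⟩ := exists_lead i hi
  obtain ⟨b, hb⟩ := exists_lead k hk
  rw [lt_rowPoly_of_isLeadingEntry hvs ha, lt_rowPoly_of_isLeadingEntry hvs hb] at hik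
  obtain rfl := hvs.injective hik
  by_contra hne
  exact ha.2 (hA.eq_zero_of_ne_of_isLeadingEntry hne hb)

theorem mem_macaulayRed {fs : List (VPoly α κ K)} {g : VPoly α κ K} :
    g ∈ macaulayRed fs ↔ g ∈ matToPolys (keysToList fs) (rowEchelon (macaulayMat fs)) ∧ g ≠ 0 ∧
      ∀ f ∈ fs, f ≠ 0 → lt f ≠ lt g := by
  simp [macaulayRed]

theorem macaulayRed_subset_span (fs : List (VPoly α κ K)) :
    {g | g ∈ macaulayRed fs} ⊆ (Submodule.span K {f | f ∈ fs} : Set (VPoly α κ K)) :=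
  fun _ hg => span_matToPolys_rowEchelon fs ▸ Submodule.subset_span (mem_macaulayRed.1 hg).1

theorem exists_mem_append_macaulayRed_lt_eq {fs : List (VPoly α κ K)} {h : VPoly α κ K}
    (hh : h ∈ Submodule.span K {f | f ∈ fs}) (h0 : h ≠ 0) :
    ∃ g ∈ fs ++ macaulayRed fs, g ≠ 0 ∧ lt g = lt h := by
  rw [← span_matToPolys_rowEchelon, matToPolys_eq] at hh
  simp only [List.mem_ofFn] at hh
  obtain ⟨i, hi, hlt⟩ := exists_lt_eq_of_mem_span (lt_rowPoly_injOn (strictAnti_get_keysToList fs)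
    (rowEchelon_isReducedRowEchelon _)) hh h0
  by_cases hold : ∃ f ∈ fs, f ≠ 0 ∧ lt f = lt h
  · obtain ⟨f, hf, hfh⟩ := hold
    exact ⟨f, List.mem_append_left _ hf, hfh⟩
  · refine ⟨_, List.mem_append_right _ (mem_macaulayRed.2 ⟨?_, hi, fun f hf hf0 hfg => ?_⟩),
      hi, hlt⟩
    · rw [matToPolys_eq, List.mem_ofFn]
      exact mem_range_self i
    · exact hold ⟨f, hf, hf0, hfg.trans hlt⟩

end Macaulay

theorem exists_whileOption_eq_some {σ : Type*} {c : σ → Prop} {f : σ → σ} {s : σ} {I : σ → Prop}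
    (h0 : I s) (hI : ∀ s, I s → c s → I (f s)) (hterm : ∃ n : ℕ, ¬ c (f^[n] s)) :
    ∃ r, whileOption c f s = some r ∧ I r ∧ ¬ c r := by
  classical
  have invariant (n : ℕ) (hn : n ≤ Nat.find hterm) : I (f^[n] s) := by
    induction n with
    | zero => exact h0
    | succ n ih =>
      rw [Function.iterate_succ_apply']
      exact hI _ (ih (n.le_succ.trans hn)) (not_not.1 (Nat.find_min hterm hn))
  refine ⟨f^[Nat.find hterm] s, ?_, invariant _ le_rfl, Nat.find_spec hterm⟩
  rw [whileOption, dif_pos hterm]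

section SymbolicPreprocessing

variable {α κ K : Type*} [CancelCommMonoid α] [Field K] [Nonempty κ] [LinearOrder (Term α κ)]

/-- `f` is the multiple of an element of `bs` whose leading term is `v`: symbolic preprocessing
adds all these multiples when it treats the term `v`. -/
def IsReducer (bs : List (VPoly α κ K)) (v : Term α κ) (f : VPoly α κ K) : Prop :=
  ∃ b ∈ bs, b ≠ 0 ∧ (lt b).Dvd v ∧ shift (ppDiv v.pp (lp b)) b = f

theorem IsReducible.exists_isReducer {bs : List (VPoly α κ K)} {v : Term α κ}
    (h : IsReducible {b | b ∈ bs} v) : ∃ f, IsReducer bs v f :=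
  let ⟨b, hb, hb0, hbv⟩ := h
  ⟨_, b, hb, hb0, hbv, rfl⟩

theorem IsReducer.ne_zero {bs : List (VPoly α κ K)} {v : Term α κ} {f : VPoly α κ K}
    (h : IsReducer bs v f) : f ≠ 0 := by
  obtain ⟨b, -, hb0, -, rfl⟩ := h
  exact shift_ne_zero _ hb0

theorem IsReducer.lt_eq [IsMonomialOrder α κ] {bs : List (VPoly α κ K)} {v : Term α κ}
    {f : VPoly α κ K} (h : IsReducer bs v f) : lt f = v := by
  obtain ⟨b, -, hb0, hbv, rfl⟩ := h
  exact (lt_shift _ hb0).trans (stimes_ppDiv hbv)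

theorem IsReducer.mem_supported {B : Set (Term α κ)} (hB : IsDicksonRegion B)
    {bs : List (VPoly α κ K)} (hbs : ∀ b ∈ bs, b ∈ Finsupp.supported K K B) {v : Term α κ}
    (hv : v ∈ B) {f : VPoly α κ K} (h : IsReducer bs v f) : f ∈ Finsupp.supported K K B := by
  obtain ⟨b, hb, -, hbv, rfl⟩ := h
  exact hB.shift_mem_supported (v := lt b) ((stimes_ppDiv hbv).symm ▸ hv) (hbs b hb)

theorem isReducer_cons {b : VPoly α κ K} {bs : List (VPoly α κ K)} {v : Term α κ}
    {f : VPoly α κ K} : IsReducer (b :: bs) v f ↔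
      ((b ≠ 0 ∧ (lt b).Dvd v) ∧ shift (ppDiv v.pp (lp b)) b = f) ∨ IsReducer bs v f := by
  simp only [IsReducer, List.mem_cons, exists_eq_or_imp, and_assoc]

theorem mem_support_tail {p : VPoly α κ K} {w : Term α κ} :
    w ∈ (tail p).support ↔ w ≠ lt p ∧ w ∈ p.support := by
  classical
  rw [tail, Finsupp.support_erase, Finset.mem_erase]

theorem mem_symPreprocAddnew_fst {bs fs : List (VPoly α κ K)} {vs : List (Term α κ)}
    {v w : Term α κ} : w ∈ (symPreprocAddnew bs vs fs v).1 ↔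
      w ∈ vs ∨ ∃ f, IsReducer bs v f ∧ w ∈ (tail f).support := by
  induction bs generalizing vs fs with
  | nil => simp [symPreprocAddnew, IsReducer]
  | cons b bs ih =>
    rw [symPreprocAddnew]
    by_cases h : b ≠ 0 ∧ (lt b).Dvd v
    · rw [if_pos h]
      simp only [ih, isReducer_cons, List.mem_append, mem_keysToList, monomMult_eq, one_smul,
        List.mem_singleton, exists_eq_left, exists_eq_left', eq_true h, true_and, or_and_right,
        exists_or, or_assoc]
    · rw [if_neg h]
      simp only [ih, isReducer_cons, eq_false h, false_and, false_or]

theorem mem_symPreprocAddnew_snd {bs fs : List (VPoly α κ K)} {vs : List (Term α κ)}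
    {v : Term α κ} {f : VPoly α κ K} :
    f ∈ (symPreprocAddnew bs vs fs v).2 ↔ f ∈ fs ∨ IsReducer bs v f := by
  classical
  induction bs generalizing vs fs with
  | nil => simp [symPreprocAddnew, IsReducer]
  | cons b bs ih =>
    have insert_iff (g : VPoly α κ K) : f ∈ (if g ∈ fs then fs else g :: fs) ↔ f ∈ fs ∨ g = f := by
      grind
    rw [symPreprocAddnew, isReducer_cons]
    by_cases h : b ≠ 0 ∧ (lt b).Dvd v
    · rw [if_pos h]
      simp only [ih, insert_iff, monomMult_eq, one_smul, eq_true h, true_and, or_assoc]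
    · rw [if_neg h]
      simp only [ih, eq_false h, false_and, false_or]

theorem exists_symPreprocStep_iff [IsMonomialOrder α κ] (bs : List (VPoly α κ K))
    {s : List (Term α κ) × List (VPoly α κ K)} (hs : s.1 ≠ []) :
    ∃ v ∈ s.1, (∀ w ∈ s.1, w ≤ v) ∧
      (∀ w, w ∈ (symPreprocStep bs s).1 ↔
        w ≠ v ∧ (w ∈ s.1 ∨ ∃ f, IsReducer bs v f ∧ w ∈ f.support)) ∧
      ∀ f, f ∈ (symPreprocStep bs s).2 ↔ f ∈ s.2 ∨ IsReducer bs v f := by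
  obtain ⟨v, hv⟩ := Option.ne_none_iff_exists'.1 (mt List.max?_eq_none_iff.1 hs)
  obtain ⟨hvs, hmax⟩ := List.max?_eq_some_iff.1 hv
  refine ⟨v, hvs, hmax, fun w => ?_, fun f => ?_⟩
  · have tail_iff (f : VPoly α κ K) :
        IsReducer bs v f ∧ w ∈ (tail f).support ↔ w ≠ v ∧ IsReducer bs v f ∧ w ∈ f.support := by
      rw [mem_support_tail, and_left_comm]
      exact and_congr_left fun h => by rw [h.1.lt_eq]
    simp only [symPreprocStep, hv, mem_symPreprocAddnew_fst, tail_iff, exists_and_left,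
      List.mem_filter, decide_eq_true_eq, and_or_left, and_comm (a := w ∈ s.1)]
  · simp only [symPreprocStep, hv, mem_symPreprocAddnew_snd]

theorem exists_iterate_symPreprocStep_eq_nil [IsMonomialOrder α κ] {B : Set (Term α κ)}
    (hB : IsDicksonRegion B) {bs : List (VPoly α κ K)}
    (hbs : ∀ b ∈ bs, b ∈ Finsupp.supported K K B) :
    ∀ s : List (Term α κ) × List (VPoly α κ K), (∀ v ∈ s.1, v ∈ B) →
      ∃ n : ℕ, ((symPreprocStep bs)^[n] s).1 = [] := by
  refine induction_on_finset_max hB.isPWO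
    (I := fun s : List (Term α κ) × List (VPoly α κ K) => ∀ v ∈ s.1, v ∈ B)
    (fun s => s.1.toFinset) (fun s hs v hv => hs v (List.mem_toFinset.1 hv)) fun s hs ih => ?_
  by_cases hnil : s.1 = []
  · exact ⟨0, hnil⟩
  obtain ⟨v, hv, hmax, hpending, -⟩ := exists_symPreprocStep_iff bs hnil
  refine (ih (symPreprocStep bs s) (fun w hw => ?_) (finset_max_lt_max (List.mem_toFinset.2 hv)
    fun w hw => ?_)).elim fun n hn => ⟨n + 1, hn⟩
  · obtain ⟨-, hw | ⟨f, hf, hw⟩⟩ := (hpending w).1 hw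
    exacts [hs w hw, hf.mem_supported hB hbs (hs v hv) hw]
  · obtain ⟨hwv, hw | ⟨f, hf, hw⟩⟩ := (hpending w).1 (List.mem_toFinset.1 hw)
    exacts [(hmax w hw).lt_of_ne hwv, (hf.lt_eq ▸ le_lt hw).lt_of_ne hwv]

/-- The invariant of symbolic preprocessing with respect to the basis `bs`, started with the
polynomials `fs₀` in a Dickson region `B`, for a state consisting of the terms still to be treated
and the polynomials collected so far. -/
structure SymPreprocInvariant (B : Set (Term α κ)) (bs fs₀ : List (VPoly α κ K))
    (s : List (Term α κ) × List (VPoly α κ K)) : Prop where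
  initial_subset : fs₀ ⊆ s.2
  initial_or_isReducer : ∀ f ∈ s.2, f ∈ fs₀ ∨ ∃ v, IsReducer bs v f
  pending_mem : ∀ v ∈ s.1, v ∈ B
  mem_supported : ∀ f ∈ s.2, f ∈ Finsupp.supported K K B
  pending_or_covered : ∀ f ∈ s.2, ∀ w ∈ f.support,
    w ∈ s.1 ∨ (IsReducible {b | b ∈ bs} w → ∃ g ∈ s.2, g ≠ 0 ∧ lt g = w)

theorem symPreprocInvariant_initial {B : Set (Term α κ)} (bs : List (VPoly α κ K))
    {fs : List (VPoly α κ K)} (hfs : ∀ f ∈ fs, f ∈ Finsupp.supported K K B) :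
    SymPreprocInvariant B bs fs (keysToList fs, fs) where
  initial_subset := List.Subset.refl _
  initial_or_isReducer _ hf := .inl hf
  pending_mem _ hv :=
    let ⟨f, hf, hvf⟩ := mem_keysToList.1 hv
    hfs f hf hvf
  mem_supported := hfs
  pending_or_covered f hf _ hw := .inl (mem_keysToList.2 ⟨f, hf, hw⟩)

theorem SymPreprocInvariant.step [IsMonomialOrder α κ] {B : Set (Term α κ)}
    (hB : IsDicksonRegion B) {bs fs₀ : List (VPoly α κ K)}
    (hbs : ∀ b ∈ bs, b ∈ Finsupp.supported K K B) {s : List (Term α κ) × List (VPoly α κ K)}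
    (h : SymPreprocInvariant B bs fs₀ s) (hs : s.1 ≠ []) :
    SymPreprocInvariant B bs fs₀ (symPreprocStep bs s) := by
  obtain ⟨v, hv, -, hpending, hcollected⟩ := exists_symPreprocStep_iff bs hs
  have reducer_mem {f : VPoly α κ K} (hf : IsReducer bs v f) : f ∈ Finsupp.supported K K B :=
    hf.mem_supported hB hbs (h.pending_mem v hv)
  constructor
  · exact fun f hf => (hcollected f).2 (.inl (h.initial_subset hf))
  · intro f hf
    exact ((hcollected f).1 hf).elim (h.initial_or_isReducer f) fun hf => .inr ⟨v, hf⟩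
  · intro w hw
    obtain ⟨-, hw | ⟨f, hf, hw⟩⟩ := (hpending w).1 hw
    exacts [h.pending_mem w hw, reducer_mem hf hw]
  · intro f hf
    exact ((hcollected f).1 hf).elim (h.mem_supported f) reducer_mem
  · intro f hf w hw
    rcases eq_or_ne w v with rfl | hwv
    · refine .inr fun hred => ?_
      obtain ⟨g, hg⟩ := hred.exists_isReducer
      exact ⟨g, (hcollected g).2 (.inr hg), hg.ne_zero, hg.lt_eq⟩
    obtain hf | hf := (hcollected f).1 hf
    · refine (h.pending_or_covered f hf w hw).imp (fun hws => (hpending w).2 ⟨hwv, .inl hws⟩)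
        fun hcov hred => ?_
      obtain ⟨g, hg, hgw⟩ := hcov hred
      exact ⟨g, (hcollected g).2 (.inl hg), hgw⟩
    · exact .inl ((hpending w).2 ⟨hwv, .inr ⟨f, hf, hw⟩⟩)

variable [GradedDicksonPowerprod α]

theorem IsDicksonRegion.shift_lcm_mem_supported {B : Set (Term α κ)} (hB : IsDicksonRegion B)
    {p q : VPoly α κ K} (hp : p ∈ Finsupp.supported K K B) (hq : q ∈ Finsupp.supported K K B) :
    shift (ppDiv (lcmTerm p q).pp (lp p)) p ∈ Finsupp.supported K K B := by
  rcases eq_or_ne p 0 with rfl | hp0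
  · rw [map_zero]
    exact zero_mem _
  have hmul : stimes (lp q) (lt p) ∈ B := by
    rcases eq_or_ne q 0 with rfl | hq0
    · rw [lp_zero, stimes_one]
      exact hp (lt_mem_support hp0)
    · exact hB.stimes_pp_mem (hq (lt_mem_support hq0)) (hp (lt_mem_support hp0))
  have hlcm : lcmTerm p q ∈ B := hB.mem_of_dvd (v := stimes (lp q) (lt p))
    ⟨rfl, GradedDicksonPowerprod.lcm_dvd _ _ _ (dvd_mul_left _ _) (dvd_mul_right _ _)⟩ hmul
  exact hB.shift_mem_supported ((stimes_ppDiv_lcmTerm p q).symm ▸ hlcm) hp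

theorem mem_pairsToList {sps : List (VPoly α κ K × VPoly α κ K)} {f : VPoly α κ K} :
    f ∈ pairsToList sps ↔ ∃ x ∈ sps,
      f = (1 / lc x.1) • shift (ppDiv (lcmTerm x.1 x.2).pp (lp x.1)) x.1 ∨
      f = (1 / lc x.2) • shift (ppDiv (lcmTerm x.2 x.1).pp (lp x.2)) x.2 := by
  simp only [pairsToList, lcmTerm, List.mem_flatMap, List.mem_cons, List.not_mem_nil, or_false,
    monomMult_eq, GradedDicksonPowerprod.lcm_comm]

theorem mem_supported_of_mem_pairsToList {B : Set (Term α κ)} (hB : IsDicksonRegion B)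
    {sps : List (VPoly α κ K × VPoly α κ K)}
    (hsps : ∀ x ∈ sps, x.1 ∈ Finsupp.supported K K B ∧ x.2 ∈ Finsupp.supported K K B)
    {f : VPoly α κ K} (hf : f ∈ pairsToList sps) : f ∈ Finsupp.supported K K B := by
  obtain ⟨x, hx, rfl | rfl⟩ := mem_pairsToList.1 hf <;> obtain ⟨hp, hq⟩ := hsps x hx
  · exact Submodule.smul_mem _ _ (hB.shift_lcm_mem_supported hp hq)
  · exact Submodule.smul_mem _ _ (hB.shift_lcm_mem_supported hq hp)

theorem exists_symPreproc_eq_some [IsMonomialOrder α κ] {B : Set (Term α κ)}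
    (hB : IsDicksonRegion B) {bs : List (VPoly α κ K)} {sps : List (VPoly α κ K × VPoly α κ K)}
    (hbs : ∀ b ∈ bs, b ∈ Finsupp.supported K K B)
    (hsps : ∀ x ∈ sps, x.1 ∈ Finsupp.supported K K B ∧ x.2 ∈ Finsupp.supported K K B) :
    ∃ fs, symPreproc bs sps = some fs ∧
      SymPreprocInvariant B bs (pairsToList sps) ([], fs) := by
  have hinit : SymPreprocInvariant B bs (pairsToList sps)
      (keysToList (pairsToList sps), pairsToList sps) :=
    symPreprocInvariant_initial bs fun _ => mem_supported_of_mem_pairsToList hB hsps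
  obtain ⟨⟨vs, fs⟩, hloop, hinv, hnil⟩ := exists_whileOption_eq_some (c := fun s => s.1 ≠ [])
    hinit (fun s h hs => h.step hB hbs hs)
    ((exists_iterate_symPreprocStep_eq_nil hB hbs _ hinit.pending_mem).imp fun _ => not_not.2)
  obtain rfl := not_not.1 hnil
  exact ⟨fs, by rw [symPreproc, hloop, Option.map_some], hinv⟩

end SymbolicPreprocessing

section F4Red

variable {α κ K : Type*} [CancelCommMonoid α] [GradedDicksonPowerprod α] [Field K]

theorem exists_isDicksonRegion_supporting (bs : List (VPoly α κ K))
    (sps : List (VPoly α κ K × VPoly α κ K)) :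
    ∃ B : Set (Term α κ), IsDicksonRegion B ∧ (∀ b ∈ bs, b ∈ Finsupp.supported K K B) ∧
      ∀ x ∈ sps, x.1 ∈ Finsupp.supported K K B ∧ x.2 ∈ Finsupp.supported K K B := by
  obtain ⟨B, hB, hsub⟩ := exists_isDicksonRegion_subset_supported
    (List.finite_toSet (bs ++ (sps.map Prod.fst ++ sps.map Prod.snd)))
  simp only [List.mem_append, List.mem_map] at hsub
  exact ⟨B, hB, fun b hb => hsub (.inl hb), fun x hx =>
    ⟨hsub (.inr (.inl ⟨x, hx, rfl⟩)), hsub (.inr (.inr ⟨x, hx, rfl⟩))⟩⟩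

variable [Nonempty κ] [LinearOrder (Term α κ)]

theorem f4Red_eq_macaulayRed {bs fs : List (VPoly α κ K)} {sps : List (VPoly α κ K × VPoly α κ K)}
    (h : symPreproc bs sps = some fs) : f4Red bs sps = macaulayRed fs := by
  rw [f4Red, h, Option.map_some, Option.getD_some]

theorem SymPreprocInvariant.exists_eq_smul_shift {B : Set (Term α κ)}
    {bs : List (VPoly α κ K)} {sps : List (VPoly α κ K × VPoly α κ K)}
    (hsps : ∀ x ∈ sps, x.1 ∈ bs ∧ x.2 ∈ bs)
    {s : List (Term α κ) × List (VPoly α κ K)}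
    (hinv : SymPreprocInvariant B bs (pairsToList sps) s) {f : VPoly α κ K} (hf : f ∈ s.2) :
    ∃ b ∈ bs, ∃ (c : K) (t : α), f = c • shift t b := by
  obtain hf | ⟨v, b, hb, -, -, rfl⟩ := hinv.initial_or_isReducer f hf
  · obtain ⟨x, hx, rfl | rfl⟩ := mem_pairsToList.1 hf
    exacts [⟨_, (hsps x hx).1, _, _, rfl⟩, ⟨_, (hsps x hx).2, _, _, rfl⟩]
  · exact ⟨b, hb, 1, _, (one_smul K _).symm⟩

theorem spoly_mem_span_of_pairsToList_subset {sps : List (VPoly α κ K × VPoly α κ K)}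
    {fs : List (VPoly α κ K)} (hfs : pairsToList sps ⊆ fs) {p q : VPoly α κ K}
    (hpq : (p, q) ∈ sps) : spoly p q ∈ Submodule.span K {f | f ∈ fs} := by
  by_cases hcomp : (lt p).comp = (lt q).comp
  · rw [spoly_eq hcomp]
    exact sub_mem (Submodule.subset_span (hfs (mem_pairsToList.2 ⟨_, hpq, .inl rfl⟩)))
      (Submodule.subset_span (hfs (mem_pairsToList.2 ⟨_, hpq, .inr rfl⟩)))
  · rw [spoly, if_neg hcomp]
    exact zero_mem _

variable [IsMonomialOrder α κ]

theorem exists_f4Red_eq_macaulayRed {B : Set (Term α κ)} (hB : IsDicksonRegion B)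
    {bs : List (VPoly α κ K)} {sps : List (VPoly α κ K × VPoly α κ K)}
    (hbs : ∀ b ∈ bs, b ∈ Finsupp.supported K K B)
    (hsps : ∀ x ∈ sps, x.1 ∈ Finsupp.supported K K B ∧ x.2 ∈ Finsupp.supported K K B) :
    ∃ fs, f4Red bs sps = macaulayRed fs ∧ SymPreprocInvariant B bs (pairsToList sps) ([], fs) :=
  let ⟨fs, hfs, hinv⟩ := exists_symPreproc_eq_some hB hbs hsps
  ⟨fs, f4Red_eq_macaulayRed hfs, hinv⟩

theorem f4Red_subset_supported {B : Set (Term α κ)} (hB : IsDicksonRegion B)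
    {bs : List (VPoly α κ K)} {sps : List (VPoly α κ K × VPoly α κ K)}
    (hbs : ∀ b ∈ bs, b ∈ Finsupp.supported K K B)
    (hsps : ∀ x ∈ sps, x.1 ∈ Finsupp.supported K K B ∧ x.2 ∈ Finsupp.supported K K B) :
    {h | h ∈ f4Red bs sps} ⊆ (Finsupp.supported K K B : Set (VPoly α κ K)) := by
  obtain ⟨fs, hred, hinv⟩ := exists_f4Red_eq_macaulayRed hB hbs hsps
  rw [hred]
  exact (macaulayRed_subset_span fs).trans (Submodule.span_le.2 hinv.mem_supported)

theorem ne_zero_and_not_isReducible_of_mem_f4Red {bs : List (VPoly α κ K)}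
    {sps : List (VPoly α κ K × VPoly α κ K)} {h : VPoly α κ K} (hh : h ∈ f4Red bs sps) :
    h ≠ 0 ∧ ¬ IsReducible {b | b ∈ bs} (lt h) := by
  obtain ⟨B, hB, hbs, hsps⟩ := exists_isDicksonRegion_supporting bs sps
  obtain ⟨fs, hred, hinv⟩ := exists_f4Red_eq_macaulayRed hB hbs hsps
  rw [hred] at hh
  obtain ⟨-, h0, hnew⟩ := mem_macaulayRed.1 hh
  refine ⟨h0, fun hreducible => ?_⟩
  have span_le : Submodule.span K {f | f ∈ fs} ≤
      Finsupp.supported K K {v | ∃ f ∈ fs, v ∈ f.support} :=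
    Submodule.span_le.2 fun f hf v hv => ⟨f, hf, hv⟩
  obtain ⟨f, hf, hv⟩ := span_le (macaulayRed_subset_span fs hh) (lt_mem_support h0)
  obtain ⟨g, hg, hg0, hgh⟩ := (hinv.pending_or_covered f hf _ hv).resolve_left
    List.not_mem_nil hreducible
  exact hnew g hg hg0 hgh

theorem f4Red_subset_pmdl {bs : List (VPoly α κ K)} {sps : List (VPoly α κ K × VPoly α κ K)}
    (hsps : ∀ x ∈ sps, x.1 ∈ bs ∧ x.2 ∈ bs) :
    {h | h ∈ f4Red bs sps} ⊆ pmdl {b | b ∈ bs} := by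
  obtain ⟨B, hB, hbs, hspsB⟩ := exists_isDicksonRegion_supporting bs sps
  obtain ⟨fs, hred, hinv⟩ := exists_f4Red_eq_macaulayRed hB hbs hspsB
  rw [hred]
  have span_le : Submodule.span K {f | f ∈ fs} ≤ multSpan {b | b ∈ bs} univ := by
    refine Submodule.span_le.2 fun f hf => ?_
    obtain ⟨b, hb, c, t, rfl⟩ := hinv.exists_eq_smul_shift hsps hf
    exact mem_pmdl.1 (.monomMult c t b (.base b hb))
  exact fun h hh => mem_pmdl.2 (span_le (macaulayRed_subset_span fs hh))

/-- Reduction to zero can be carried out inside the row space of the Macaulay matrix, because every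
leading term of the row space is the leading term of a row or of a new polynomial. -/
theorem redStar_append_f4Red_spoly {bs : List (VPoly α κ K)}
    {sps : List (VPoly α κ K × VPoly α κ K)} (hsps : ∀ x ∈ sps, x.1 ∈ bs ∧ x.2 ∈ bs)
    {p q : VPoly α κ K} (hpq : (p, q) ∈ sps) :
    RedStar {b | b ∈ bs ++ f4Red bs sps} (spoly p q) 0 := by
  obtain ⟨B, hB, hbs, hspsB⟩ := exists_isDicksonRegion_supporting bs sps
  obtain ⟨fs, hred, hinv⟩ := exists_f4Red_eq_macaulayRed hB hbs hspsB
  rw [hred]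
  refine redStar_zero_of_forall_exists_lt_eq hB (Submodule.span_le.2 hinv.mem_supported)
    (fun h hh h0 => ?_) _ (spoly_mem_span_of_pairsToList_subset hinv.initial_subset hpq)
  obtain ⟨g, hg, hg0, hgh⟩ := exists_mem_append_macaulayRed_lt_eq hh h0
  obtain hg | hg := List.mem_append.1 hg
  · obtain ⟨b, hb, c, t, rfl⟩ := hinv.exists_eq_smul_shift hsps hg
    obtain ⟨hc, hshift⟩ := smul_ne_zero_iff.1 hg0
    have hb0 : b ≠ 0 := fun h => hshift (by rw [h, map_zero])
    refine ⟨b, List.mem_append_left _ hb, hb0, t, ?_, ?_⟩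
    · exact (Submodule.smul_mem_iff _ hc).1 (Submodule.subset_span hg)
    · rw [← hgh, lt_smul hc hshift, lt_shift t hb0]
  · refine ⟨g, List.mem_append_right _ hg, hg0, 1, ?_, (stimes_one _).trans hgh⟩
    rw [shift_one]
    exact macaulayRed_subset_span fs hg

end F4Red

/-! ### The algorithm schema -/

section Pairs

variable {β : Type*}

theorem mem_of_mem_distinctPairs {l : List β} {x : β × β} (h : x ∈ distinctPairs l) :
    x.1 ∈ l ∧ x.2 ∈ l := by
  induction l with
  | nil => cases h
  | cons a l ih =>
    obtain h | h := List.mem_append.1 h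
    · obtain ⟨b, hb, rfl⟩ := List.mem_map.1 h
      exact ⟨List.mem_cons_self, List.mem_cons_of_mem _ hb⟩
    · exact (ih h).imp (List.mem_cons_of_mem a) (List.mem_cons_of_mem a)

theorem mem_distinctPairs_or {l : List β} {p q : β} (hp : p ∈ l) (hq : q ∈ l) (hpq : p ≠ q) :
    (p, q) ∈ distinctPairs l ∨ (q, p) ∈ distinctPairs l := by
  induction l with
  | nil => cases hp
  | cons a l ih =>
    simp only [distinctPairs, List.mem_append, List.mem_map]
    rcases List.mem_cons.1 hp with rfl | hp' <;> rcases List.mem_cons.1 hq with rfl | hq'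
    · exact absurd rfl hpq
    · exact .inl (.inl ⟨q, hq', rfl⟩)
    · exact .inr (.inl ⟨p, hp', rfl⟩)
    · exact (ih hp' hq').imp .inr .inr

open Classical in
theorem mem_addPairs {bs hs : List β} {ps : List (β × β)} {x : β × β} :
    x ∈ addPairs bs ps hs ↔
      x ∈ ps ∨ (x.1 ∈ hs ∧ x.2 ∈ bs) ∨ x ∈ distinctPairs hs.dedup := by
  simp only [addPairs, List.mem_append, List.mem_flatMap, List.mem_map, Prod.ext_iff, or_assoc]
  grind

theorem mem_append_of_mem_addPairs {bs hs : List β} {ps : List (β × β)}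
    (hps : ∀ x ∈ ps, x.1 ∈ bs ∧ x.2 ∈ bs) {x : β × β} (hx : x ∈ addPairs bs ps hs) :
    x.1 ∈ bs ++ hs ∧ x.2 ∈ bs ++ hs := by
  classical
  simp only [List.mem_append]
  obtain hx | ⟨h₁, h₂⟩ | hx := mem_addPairs.1 hx
  · exact (hps x hx).imp .inl .inl
  · exact ⟨.inr h₁, .inl h₂⟩
  · exact (mem_of_mem_distinctPairs hx).imp (fun h => .inr (List.mem_dedup.1 h))
      fun h => .inr (List.mem_dedup.1 h)

theorem mem_addPairs_or {bs hs : List β} (ps : List (β × β)) {p q : β} (hp : p ∈ bs ++ hs)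
    (hq : q ∈ bs ++ hs) (hpq : p ≠ q) :
    (p, q) ∈ addPairs bs ps hs ∨ (q, p) ∈ addPairs bs ps hs ∨ (p ∈ bs ∧ q ∈ bs) := by
  classical
  simp only [mem_addPairs]
  rcases List.mem_append.1 hp with hp | hp <;> rcases List.mem_append.1 hq with hq | hq
  · exact .inr (.inr ⟨hp, hq⟩)
  · exact .inr (.inl (.inr (.inl ⟨hq, hp⟩)))
  · exact .inl (.inr (.inl ⟨hp, hq⟩))
  · obtain h | h := mem_distinctPairs_or (List.mem_dedup.2 hp) (List.mem_dedup.2 hq) hpq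
    exacts [.inl (.inr (.inr h)), .inr (.inl (.inr (.inr h)))]

theorem addPairs_nil (bs : List β) (ps : List (β × β)) : addPairs bs ps [] = ps := by
  simp [addPairs, distinctPairs]

theorem mem_diffList {xs ys : List β} {x : β} : x ∈ diffList xs ys ↔ x ∈ xs ∧ x ∉ ys := by
  simp [diffList]

theorem length_diffList_lt {xs ys : List β} (h : ys ≠ []) (hsub : ys ⊆ xs) :
    (diffList xs ys).length < xs.length := by
  obtain ⟨y, hy⟩ := List.exists_mem_of_ne_nil ys h
  exact List.length_filter_lt_length_iff_exists.2 ⟨y, hsub hy, by simpa using hy⟩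

/-- One iteration of the algorithm schema, for the pairs selected by `sel` and the new polynomials
computed by `compl`. -/
noncomputable def gbStep (sel : List β → List (β × β) → List (β × β))
    (compl : List β → List (β × β) → List (β × β) → List β) (s : List β × List (β × β)) :
    List β × List (β × β) :=
  let sps := sel s.1 s.2
  let ps₀ := diffList s.2 sps
  let hs := compl s.1 ps₀ sps
  (s.1 ++ hs, addPairs s.1 ps₀ hs)

/-- The requirement on the function of the algorithm schema that selects pairs. -/
def IsSelection (sel : List β → List (β × β) → List (β × β)) : Prop :=
  ∀ bs ps, ps ≠ [] → sel bs ps ≠ [] ∧ sel bs ps ⊆ ps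

end Pairs

section Schema

variable {α κ K : Type*} [CancelCommMonoid α] [Field K] [Nonempty κ] [LinearOrder (Term α κ)]

/-- `G` enlarges `F` by a polynomial whose leading term lies in `B` and is not reducible
modulo `F`. -/
def AddsLeadingTerm (B : Set (Term α κ)) (G F : Set (VPoly α κ K)) : Prop :=
  F ⊆ G ∧ ∃ g ∈ G, g ≠ 0 ∧ lt g ∈ B ∧ ¬ IsReducible F (lt g)

theorem IsDicksonRegion.wellFounded_addsLeadingTerm {B : Set (Term α κ)} (hB : IsDicksonRegion B) :
    WellFounded (AddsLeadingTerm B : Set (VPoly α κ K) → Set (VPoly α κ K) → Prop) := by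
  refine wellFounded_iff_isEmpty_descending_chain.2 ⟨fun ⟨F, hF⟩ => ?_⟩
  have mono : Monotone F := monotone_nat_of_le_succ fun n => (hF n).1
  choose g hg hg0 hgB hgF using fun n => (hF n).2
  obtain ⟨i, j, hij, hdvd⟩ := hB.partiallyWellOrderedOn.exists_lt hgB
  exact hgF j ⟨g i, mono hij (hg i), hg0 i, hdvd⟩

theorem multSpan_append_of_subset_pmdl {bs hs : List (VPoly α κ K)}
    (h : {h | h ∈ hs} ⊆ pmdl {b | b ∈ bs}) :
    multSpan {b | b ∈ bs ++ hs} univ = multSpan {b | b ∈ bs} univ :=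
  le_antisymm
    (multSpan_univ_le fun f hf =>
      (List.mem_append.1 hf).elim (pmdl.base (B := {b | b ∈ bs}) f ·) (h ·))
    (multSpan_mono_left (fun _ hb => List.mem_append_left _ hb) _)

variable [GradedDicksonPowerprod α]

/-- The requirements on the function of the algorithm schema that computes new polynomials from
the basis `bs`, the pairs `ps` that have not been selected, and the selected pairs `sps`. -/
structure IsCompletion (compl : List (VPoly α κ K) → List (VPoly α κ K × VPoly α κ K) →
    List (VPoly α κ K × VPoly α κ K) → List (VPoly α κ K)) : Prop where
  ne_zero_and_not_isReducible : ∀ bs ps sps, ∀ h ∈ compl bs ps sps,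
    h ≠ 0 ∧ ¬ IsReducible {b | b ∈ bs} (lt h)
  mem_supported : ∀ ⦃B : Set (Term α κ)⦄, IsDicksonRegion B → ∀ bs ps sps,
    (∀ x ∈ sps, x.1 ∈ bs ∧ x.2 ∈ bs) → (∀ b ∈ bs, b ∈ Finsupp.supported K K B) →
      ∀ h ∈ compl bs ps sps, h ∈ Finsupp.supported K K B
  subset_pmdl : ∀ bs ps sps, (∀ x ∈ sps, x.1 ∈ bs ∧ x.2 ∈ bs) →
    {h | h ∈ compl bs ps sps} ⊆ pmdl {b | b ∈ bs}
  isResolved : ∀ bs ps sps, (∀ x ∈ sps, x.1 ∈ bs ∧ x.2 ∈ bs) → ∀ p q, (p, q) ∈ sps →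
    IsResolved {b | b ∈ bs ++ compl bs ps sps} univ p q

/-- The invariant of the algorithm schema, run inside the Dickson region `B` on the input `bs`, for
a state consisting of the current basis and the pairs still to be considered. -/
structure SchemaInvariant (B : Set (Term α κ)) (bs : List (VPoly α κ K))
    (s : List (VPoly α κ K) × List (VPoly α κ K × VPoly α κ K)) : Prop where
  pairs_mem : ∀ x ∈ s.2, x.1 ∈ s.1 ∧ x.2 ∈ s.1
  pending_or_isResolved : ∀ p ∈ s.1, ∀ q ∈ s.1,
    (p, q) ∈ s.2 ∨ (q, p) ∈ s.2 ∨ IsResolved {b | b ∈ s.1} univ p q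
  mem_supported : ∀ b ∈ s.1, b ∈ Finsupp.supported K K B
  multSpan_eq : multSpan {b | b ∈ s.1} univ = multSpan {b | b ∈ bs} univ

theorem schemaInvariant_initial {B : Set (Term α κ)} {bs : List (VPoly α κ K)}
    (hbs : ∀ b ∈ bs, b ∈ Finsupp.supported K K B) :
    SchemaInvariant B bs (bs, addPairs [] [] bs) where
  pairs_mem _ hx := mem_append_of_mem_addPairs (bs := []) (by simp) hx
  pending_or_isResolved p hp q hq := by
    rcases eq_or_ne p q with rfl | hpq
    · exact .inr (.inr (isResolved_self _ _ p))
    · obtain h | h | ⟨h, -⟩ := mem_addPairs_or (bs := []) [] hp hq hpq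
      exacts [.inl h, .inr (.inl h), absurd h List.not_mem_nil]
  mem_supported := hbs
  multSpan_eq := rfl

variable {sel : List (VPoly α κ K) → List (VPoly α κ K × VPoly α κ K) →
    List (VPoly α κ K × VPoly α κ K)}
  {compl : List (VPoly α κ K) → List (VPoly α κ K × VPoly α κ K) →
    List (VPoly α κ K × VPoly α κ K) → List (VPoly α κ K)}

theorem SchemaInvariant.step (hsel : IsSelection sel) (hcompl : IsCompletion compl)
    {B : Set (Term α κ)} (hB : IsDicksonRegion B) {bs : List (VPoly α κ K)}
    {s : List (VPoly α κ K) × List (VPoly α κ K × VPoly α κ K)}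
    (h : SchemaInvariant B bs s) (hs : s.2 ≠ []) :
    SchemaInvariant B bs (gbStep sel compl s) := by
  set sps := sel s.1 s.2
  set ps₀ := diffList s.2 sps
  have selected_mem (x) (hx : x ∈ sps) : x.1 ∈ s.1 ∧ x.2 ∈ s.1 :=
    h.pairs_mem x ((hsel _ _ hs).2 hx)
  have pending_or_isResolved {p q : VPoly α κ K} (hpq : (p, q) ∈ s.2) :
      (p, q) ∈ (gbStep sel compl s).2 ∨
        IsResolved {b | b ∈ (gbStep sel compl s).1} univ p q := by
    by_cases hsps : (p, q) ∈ sps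
    · exact .inr (hcompl.isResolved _ _ _ selected_mem p q hsps)
    · classical exact .inl (mem_addPairs.2 (.inl (mem_diffList.2 ⟨hpq, hsps⟩)))
  constructor
  · exact fun x => mem_append_of_mem_addPairs fun y hy => h.pairs_mem y (mem_diffList.1 hy).1
  · intro p hp q hq
    rcases eq_or_ne p q with rfl | hpq
    · exact .inr (.inr (isResolved_self _ _ p))
    obtain h' | h' | ⟨hp, hq⟩ := mem_addPairs_or ps₀ hp hq hpq
    · exact .inl h'
    · exact .inr (.inl h')
    obtain h' | h' | h' := h.pending_or_isResolved p hp q hq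
    · exact (pending_or_isResolved h').imp_right .inr
    · exact .inr ((pending_or_isResolved h').imp_right .symm)
    · exact .inr (.inr (h'.mono_left fun b hb => List.mem_append_left _ hb))
  · exact fun b hb => (List.mem_append.1 hb).elim (h.mem_supported b)
      (hcompl.mem_supported hB _ _ _ selected_mem h.mem_supported b)
  · exact (multSpan_append_of_subset_pmdl (hcompl.subset_pmdl _ _ _ selected_mem)).trans
      h.multSpan_eq

theorem IsCompletion.addsLeadingTerm (hcompl : IsCompletion compl) {B : Set (Term α κ)}
    (hB : IsDicksonRegion B) {bs : List (VPoly α κ K)}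
    (hbs : ∀ b ∈ bs, b ∈ Finsupp.supported K K B) {ps sps : List (VPoly α κ K × VPoly α κ K)}
    (hsps : ∀ x ∈ sps, x.1 ∈ bs ∧ x.2 ∈ bs) (hne : compl bs ps sps ≠ []) :
    AddsLeadingTerm B {b | b ∈ bs ++ compl bs ps sps} {b | b ∈ bs} := by
  obtain ⟨h, hh⟩ := List.exists_mem_of_ne_nil _ hne
  obtain ⟨h0, hirred⟩ := hcompl.ne_zero_and_not_isReducible bs ps sps h hh
  exact ⟨fun b => List.mem_append_left _, h, List.mem_append_right _ hh, h0,
    hcompl.mem_supported hB bs ps sps hsps hbs h hh (lt_mem_support h0), hirred⟩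

/-- Every iteration adds a new leading term or, leaving the basis unchanged, removes a pair. -/
theorem SchemaInvariant.exists_iterate_gbStep_eq_nil (hsel : IsSelection sel)
    (hcompl : IsCompletion compl) {B : Set (Term α κ)} (hB : IsDicksonRegion B)
    {bs : List (VPoly α κ K)} {s : List (VPoly α κ K) × List (VPoly α κ K × VPoly α κ K)}
    (h : SchemaInvariant B bs s) : ∃ n : ℕ, ((gbStep sel compl)^[n] s).2 = [] := by
  let measure (s : List (VPoly α κ K) × List (VPoly α κ K × VPoly α κ K)) :
      Set (VPoly α κ K) × ℕ := ({b | b ∈ s.1}, s.2.length)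
  have wf := InvImage.wf measure (hB.wellFounded_addsLeadingTerm.prod_lex Nat.lt_wfRel.wf)
  induction s using wf.induction with
  | _ s ih =>
    by_cases hs : s.2 = []
    · exact ⟨0, hs⟩
    refine (ih (gbStep sel compl s) ?_ (h.step hsel hcompl hB hs)).elim fun n hn => ⟨n + 1, hn⟩
    obtain ⟨hne, hsub⟩ := hsel s.1 s.2 hs
    by_cases hnil : compl s.1 (diffList s.2 (sel s.1 s.2)) (sel s.1 s.2) = []
    · have hstep : gbStep sel compl s = (s.1, diffList s.2 (sel s.1 s.2)) := by
        simp only [gbStep, hnil, List.append_nil, addPairs_nil]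
      rw [hstep]
      exact Prod.Lex.right _ (length_diffList_lt hne hsub)
    · exact Prod.Lex.left _ _ (hcompl.addsLeadingTerm hB h.mem_supported
        (fun x hx => h.pairs_mem x (hsub hx)) hnil)

theorem SchemaInvariant.isReducible_lt [IsMonomialOrder α κ] {B : Set (Term α κ)}
    {bs gs : List (VPoly α κ K)} {ps : List (VPoly α κ K × VPoly α κ K)}
    (h : SchemaInvariant B bs (gs, ps)) (hexit : ps = [] ∨ GenWholeModule gs) {p : VPoly α κ K}
    (hp : p ∈ multSpan {g | g ∈ gs} univ) (hp0 : p ≠ 0) : IsReducible {g | g ∈ gs} (lt p) := by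
  obtain rfl | hwhole := hexit
  · refine isReducible_lt_of_isResolved (List.finite_toSet gs) (fun f hf g hg => ?_) hp hp0
    simpa using h.pending_or_isResolved f hf g hg
  · exact hwhole.isReducible hp (lt_mem_support hp0)

theorem exists_gbSchema_eq_some [IsMonomialOrder α κ] (hsel : IsSelection sel)
    (hcompl : IsCompletion compl) (bs : List (VPoly α κ K)) :
    ∃ gs, gbSchema sel compl bs = some gs ∧ IsGroebnerBasis {g | g ∈ gs} ∧
      pmdl {g | g ∈ gs} = pmdl {b | b ∈ bs} := by
  obtain ⟨B, hB, hbs⟩ := exists_isDicksonRegion_subset_supported (List.finite_toSet bs)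
  have hinit : SchemaInvariant B bs (bs, addPairs [] [] bs) := schemaInvariant_initial hbs
  obtain ⟨⟨gs, ps⟩, hloop, hinv, hexit⟩ := exists_whileOption_eq_some
    (c := fun s => ¬ (s.2 = [] ∨ GenWholeModule s.1)) hinit
    (fun s h hs => h.step hsel hcompl hB (not_or.1 hs).1)
    ((hinit.exists_iterate_gbStep_eq_nil hsel hcompl hB).imp fun n hn => not_not.2 (.inl hn))
  refine ⟨gs, congrArg (Option.map Prod.fst) hloop, ?_, ?_⟩
  · exact isGroebnerBasis_of_isReducible_lt (List.finite_toSet gs) fun p hp hp0 =>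
      hinv.isReducible_lt (not_not.1 hexit) hp hp0
  · ext p
    exact mem_pmdl.trans ((SetLike.ext_iff.1 hinv.multSpan_eq p).trans mem_pmdl.symm)

end Schema

section Completion

variable {α κ K : Type*} [CancelCommMonoid α] [GradedDicksonPowerprod α] [Nonempty κ]
  [LinearOrder (Term α κ)] [IsMonomialOrder α κ] [Field K]

theorem isCompletion_f4Red {keep : List (VPoly α κ K) → List (VPoly α κ K × VPoly α κ K) →
      List (VPoly α κ K × VPoly α κ K) → List (VPoly α κ K × VPoly α κ K)}
    (hkeep : ∀ bs ps sps, keep bs ps sps ⊆ sps ∧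
      ∀ p q, (p, q) ∈ sps → (p, q) ∉ keep bs ps sps → IsDiscardable bs p q) :
    IsCompletion fun bs ps sps => f4Red bs (keep bs ps sps) where
  ne_zero_and_not_isReducible _ _ _ _ hh := ne_zero_and_not_isReducible_of_mem_f4Red hh
  mem_supported _ hB bs ps sps hsps hbs _ hh := f4Red_subset_supported hB hbs
    (fun x hx => (hsps x ((hkeep bs ps sps).1 hx)).imp (hbs _) (hbs _)) hh
  subset_pmdl bs ps sps hsps := f4Red_subset_pmdl fun x hx => hsps x ((hkeep bs ps sps).1 hx)
  isResolved bs ps sps hsps p q hpq := by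
    by_cases hkept : (p, q) ∈ keep bs ps sps
    · exact isResolved_of_redStar (redStar_append_f4Red_spoly
        (fun x hx => hsps x ((hkeep bs ps sps).1 hx)) hkept)
    · obtain ⟨hp, hq⟩ := hsps _ hpq
      exact (((hkeep bs ps sps).2 p q hpq hkept).isResolved hp hq).mono_left
        fun b => List.mem_append_left _

end Completion

end F4

theorem mainTheorem3_general {α κ K : Type*} [CancelCommMonoid α] [GradedDicksonPowerprod α]
    [Nonempty κ] [Field K] [LinearOrder (Term α κ)] [IsMonomialOrder α κ] :
    (∀ (bs : List (VPoly α κ K)) (sps : List (VPoly α κ K × VPoly α κ K)),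
      ∃ fs, symPreproc bs sps = some fs ∧ f4Red bs sps = macaulayRed fs) ∧
    (∀ (bs : List (VPoly α κ K)) (sps : List (VPoly α κ K × VPoly α κ K)),
      ∀ h ∈ f4Red bs sps, h ≠ 0 ∧ ∀ b ∈ bs, b ≠ 0 → ¬ (lt b).Dvd (lt h)) ∧
    (∀ (bs : List (VPoly α κ K)) (sps : List (VPoly α κ K × VPoly α κ K)),
      (∀ x ∈ sps, x.1 ∈ bs ∧ x.2 ∈ bs) →
        (∀ h ∈ f4Red bs sps, h ∈ pmdl {b | b ∈ bs}) ∧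
        ∀ p q, (p, q) ∈ sps → RedStar {b | b ∈ bs ++ f4Red bs sps} (spoly p q) 0) ∧
    (∀ (sel : List (VPoly α κ K) → List (VPoly α κ K × VPoly α κ K) →
          List (VPoly α κ K × VPoly α κ K))
        (keep : List (VPoly α κ K) → List (VPoly α κ K × VPoly α κ K) →
          List (VPoly α κ K × VPoly α κ K) → List (VPoly α κ K × VPoly α κ K)),
      (∀ bs ps, ps ≠ [] → sel bs ps ≠ [] ∧ sel bs ps ⊆ ps) →
      (∀ bs ps sps, keep bs ps sps ⊆ sps ∧
        ∀ p q, (p, q) ∈ sps → (p, q) ∉ keep bs ps sps → IsDiscardable bs p q) →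
      ∀ bs : List (VPoly α κ K), ∃ gs : List (VPoly α κ K), f4 sel keep bs = some gs ∧
        IsGroebnerBasis {g | g ∈ gs} ∧ pmdl {g | g ∈ gs} = pmdl {b | b ∈ bs}) := by
  refine ⟨fun bs sps => ?_, fun bs sps h hh => ?_, fun bs sps hsps => ⟨?_, ?_⟩,
    fun sel keep hsel hkeep bs => ?_⟩
  · obtain ⟨B, hB, hbs, hsps⟩ := exists_isDicksonRegion_supporting bs sps
    obtain ⟨fs, hfs, -⟩ := exists_symPreproc_eq_some hB hbs hsps
    exact ⟨fs, hfs, f4Red_eq_macaulayRed hfs⟩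
  · obtain ⟨h0, hirred⟩ := ne_zero_and_not_isReducible_of_mem_f4Red hh
    exact ⟨h0, fun b hb hb0 hdvd => hirred ⟨b, hb, hb0, hdvd⟩⟩
  · exact f4Red_subset_pmdl hsps
  · exact fun p q => redStar_append_f4Red_spoly hsps
  · exact exists_gbSchema_eq_some hsel (isCompletion_f4Red hkeep) bs

theorem mainTheorem3 {α κ K : Type*} [CancelCommMonoid α] [GradedDicksonPowerprod α]
    [LinearOrder κ] [WellFoundedLT κ] [Nonempty κ] [Field K]
    [LinearOrder α] [LinearOrder (Term α κ)] [IsTermOrder α κ] :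
    -- symbolic preprocessing terminates
    (∀ (bs : List (VPoly α κ K)) (sps : List (VPoly α κ K × VPoly α κ K)),
      ∃ fs, symPreproc bs sps = some fs ∧ f4Red bs sps = macaulayRed fs) ∧
    -- the new polynomials are non-zero with leading terms not divisible by old leading terms
    (∀ (bs : List (VPoly α κ K)) (sps : List (VPoly α κ K × VPoly α κ K)),
      ∀ h ∈ f4Red bs sps, h ≠ 0 ∧ ∀ b ∈ bs, b ≠ 0 → ¬ (lt b).Dvd (lt h)) ∧
    -- they lie in the submodule generated by the basis, and all selected S-polynomials reduce to 0
    (∀ (bs : List (VPoly α κ K)) (sps : List (VPoly α κ K × VPoly α κ K)),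
      (∀ x ∈ sps, x.1 ∈ bs ∧ x.2 ∈ bs) →
        (∀ h ∈ f4Red bs sps, h ∈ pmdl {b | b ∈ bs}) ∧
        ∀ p q, (p, q) ∈ sps → RedStar {b | b ∈ bs ++ f4Red bs sps} (spoly p q) 0) ∧
    -- F4 terminates and computes a Gröbner basis of the submodule generated by its input
    (∀ (sel : List (VPoly α κ K) → List (VPoly α κ K × VPoly α κ K) →
          List (VPoly α κ K × VPoly α κ K))
        (keep : List (VPoly α κ K) → List (VPoly α κ K × VPoly α κ K) →
          List (VPoly α κ K × VPoly α κ K) → List (VPoly α κ K × VPoly α κ K)),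
      (∀ bs ps, ps ≠ [] → sel bs ps ≠ [] ∧ sel bs ps ⊆ ps) →
      (∀ bs ps sps, keep bs ps sps ⊆ sps ∧
        ∀ p q, (p, q) ∈ sps → (p, q) ∉ keep bs ps sps → IsDiscardable bs p q) →
      ∀ bs : List (VPoly α κ K), ∃ gs : List (VPoly α κ K), f4 sel keep bs = some gs ∧
        IsGroebnerBasis {g | g ∈ gs} ∧ pmdl {g | g ∈ gs} = pmdl {b | b ∈ bs}) :=
  mainTheorem3_general
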